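/- Let $p$ be a natural number and let $(X,\sigma)$ be a one-sided or two-sided shift space over an alphabet of $p$ symbols, i.e. a closed shift-invariant set of sequences indexed by $\mathbb{N}$ or by $\mathbb{Z}$. Let $\mathcal{L}$ be its language, the set of all finite words (including the empty word) that appear in points of $X$. For a collection of words $\mathcal{D}\subset\mathcal{L}$ let $\mathcal{D}_n$ be the set of words of length $n$ in $\mathcal{D}$, and put $h(\mathcal{D})=\limsup_{n\to\infty}\frac1n\log\#\mathcal{D}_n\in[-\infty,\infty)$, with $\log 0=-\infty$. Suppose that $\mathcal{C}^p,\mathcal{G},\mathcal{C}^s\subset\mathcal{L}$ are collections of words such that every word of $\mathcal{L}$ is a concatenation $uvw$ with $u\in\mathcal{C}^p$, $v\in\mathcal{G}$, $w\in\mathcal{C}^s$, and for $M\in\mathbb{N}$ let $\mathcal{G}(M)$ be the set of words of $\mathcal{L}$ of the form $uvw$ with $u\in\mathcal{C}^p$, $v\in\mathcal{G}$, $w\in\mathcal{C}^s$, $|u|\le M$, $|w|\le M$. Suppose that: (I) $\mathcal{G}$ has (S)-specification: there is $t\in\mathbb{N}$ such that for all $m\ge1$ and $w^1,\dots,w^m\in\mathcal{G}$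 there are $v^1,\dots,v^{m-1}\in\mathcal{L}$ with $|v^i|=t$ for all $i$ and $x:=w^1v^1w^2v^2\cdots v^{m-1}w^m\in\mathcal{L}$; (II) $h(\mathcal{C}^p\cup\mathcal{C}^s)<h_{\mathrm{top}}(X,\sigma)$, the topological entropy; (III) for every $M\in\mathbb{N}$ there is $\tau$ such that for every $v\in\mathcal{G}(M)$ there are words $u,w$ with $|u|\le\tau$, $|w|\le\tau$ and $uvw\in\mathcal{G}$. Then $(X,\sigma)$ is intrinsically ergodic: there is exactly one $\sigma$-invariant Borel probability measure on $X$ whose entropy $h_\mu(\sigma)$ equals the supremum of the entropies of all $\sigma$-invariant Borel probability measures (a measure of maximal entropy). Suppose moreover that $\mathcal{G}$ has (Per)-specification, i.e. there is $t\in\mathbb{N}$ such that in the situation of (I) the words $v^i$ with $|v^i|=t$ can be chosen so that $x\in\mathcal{L}$ and the cylinder $[x]$ also contains a point $y$ with $\sigma^{|x|+t}y=y$. Let $\mathrm{Per}(n)=\{x\in X\mid\sigma^kx=x\text{ for some }1\le k\le n\}$. Then $\mathrm{Per}(n)$ is finite and non-empty for all sufficiently large $n$, and the probability measures $\mu_n=\frac1{\#\mathrm{Per}(n)}\sum_{x\in\mathrm{Per}(n)}\delta_x$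 converge in the weak* topology to the unique measure of maximal entropy as $n\to\infty$. -/

import Mathlib

open Set Filter Topology MeasureTheory
open SymbolicDynamics.FullShift (Subshift)

noncomputable section

namespace ShiftSpace

/-! ### Measure-theoretic entropy and measures of maximal entropy -/

section Entropy

variable {Y : Type*} [MeasurableSpace Y]

/-- Shannon entropy `H_μ(ξ) = ∑ -μ(ξ = a) log μ(ξ = a)` of the finite partition of `Y` into the
level sets of `ξ : Y → ι`. -/
def partitionEntropy {ι : Type*} [Fintype ι] (μ : Measure Y) (ξ : Y → ι) : ℝ :=
  ∑ a, Real.negMulLog (μ.real (ξ ⁻¹' {a}))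

/-- The labelling of the refined partition `ξ ∨ T⁻¹ξ ∨ ⋯ ∨ T^{-(n-1)}ξ`. -/
def itinerary {ι : Type*} (T : Y → Y) (ξ : Y → ι) (n : ℕ) : Y → (Fin n → ι) :=
  fun y i => ξ (T^[(i : ℕ)] y)

/-- The entropy `h_μ(T, ξ)` of `T` relative to the finite partition `ξ`; for `T`-invariant `μ` the
upper limit is a limit, by subadditivity. -/
def entropyRate {ι : Type*} [Fintype ι] (T : Y → Y) (μ : Measure Y) (ξ : Y → ι) : EReal :=
  limsup (fun n : ℕ => ((partitionEntropy μ (itinerary T ξ n) / n : ℝ) : EReal)) atTop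

/-- The Kolmogorov-Sinai entropy `h_μ(T)`: the supremum of `h_μ(T, ξ)` over all finite measurable
partitions. -/
def measureEntropy (T : Y → Y) (μ : Measure Y) : EReal :=
  ⨆ (k : ℕ) (ξ : Y → Fin k) (_ : Measurable ξ), entropyRate T μ ξ

/-- `μ` is a measure of maximal entropy: it is `T`-invariant and attains the supremum of the
entropies of all `T`-invariant probability measures. -/
def IsMME (T : Y → Y) (μ : ProbabilityMeasure Y) : Prop :=
  MeasurePreserving T (μ : Measure Y) (μ : Measure Y) ∧
    measureEntropy T (μ : Measure Y) =
      ⨆ (ν : ProbabilityMeasure Y) (_ : MeasurePreserving T (ν : Measure Y) (ν : Measure Y)),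
        measureEntropy T (ν : Measure Y)

/-- Existence and uniqueness of a measure of maximal entropy. -/
def IntrinsicallyErgodic (T : Y → Y) : Prop :=
  ∃! μ : ProbabilityMeasure Y, IsMME T μ

end Entropy

/-! ### Collections of words -/

section Words

variable {A : Type*}

/-- The growth rate `h(D) = limsup (1/n) log #D_n` of a collection of words, with values in
`[-∞, ∞]`; here `log 0 = -∞`. -/
def growthRate (D : Set (List A)) : EReal :=
  ExpGrowth.expGrowthSup fun n : ℕ => (({w ∈ D | w.length = n}.encard : ℕ∞) : ENNReal)

/-- `L = Cp G Cs`: the three collections consist of words of `L`, and every word of `L` is a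
concatenation of a word of `Cp`, a word of `G` and a word of `Cs`, in that order. -/
def IsDecomposition (L Cp G Cs : Set (List A)) : Prop :=
  Cp ⊆ L ∧ G ⊆ L ∧ Cs ⊆ L ∧ ∀ x ∈ L, ∃ u ∈ Cp, ∃ v ∈ G, ∃ w ∈ Cs, x = u ++ v ++ w

/-- The collection `G(M)` of words of `L` of the form `uvw` with `u ∈ Cp`, `v ∈ G`, `w ∈ Cs` and
`|u|, |w| ≤ M`. -/
def goodWords (L Cp G Cs : Set (List A)) (M : ℕ) : Set (List A) :=
  {x ∈ L | ∃ u ∈ Cp, ∃ v ∈ G, ∃ w ∈ Cs, u.length ≤ M ∧ w.length ≤ M ∧ x = u ++ v ++ w}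

/-- For lists of words `[w¹, …, wᵐ]` and `[v¹, …, vᵐ⁻¹]`, the word `w¹ v¹ w² v² ⋯ vᵐ⁻¹ wᵐ`. -/
def glue : List (List A) → List (List A) → List A
  | w :: ws, v :: vs => w ++ v ++ glue ws vs
  | ws, _ => ws.flatten

/-- `vs` is a list of connecting words in `L`, each of length `t`, which glues the words `ws`
together to a word of `L`. -/
def IsGluing (L : Set (List A)) (t : ℕ) (ws vs : List (List A)) : Prop :=
  vs.length + 1 = ws.length ∧ (∀ v ∈ vs, v ∈ L ∧ v.length = t) ∧ glue ws vs ∈ L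

/-- (S)-specification on `G` with gap size `t`. -/
def HasSSpecification (L G : Set (List A)) (t : ℕ) : Prop :=
  ∀ ws : List (List A), ws ≠ [] → (∀ w ∈ ws, w ∈ G) → ∃ vs, IsGluing L t ws vs

/-- For every `M` there is `τ` such that each word of `G(M)` can be extended to a word of `G` by
adding at most `τ` symbols on either side. -/
def HasBoundedExtension (L Cp G Cs : Set (List A)) : Prop :=
  ∀ M : ℕ, ∃ τ : ℕ, ∀ v ∈ goodWords L Cp G Cs M,
    ∃ u w : List A, u.length ≤ τ ∧ w.length ≤ τ ∧ u ++ v ++ w ∈ G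

end Words

/-! ### Shift spaces

The index set `I` is `ℕ` for one-sided and `ℤ` for two-sided shift spaces. -/

section Shifts

variable {p : ℕ} {I : Type*} [AddMonoidWithOne I]

/-- The shift map `σ` on a shift space: `(σ x)_i = x_{1+i}`. -/
def shiftMap (X : Subshift (Fin p) I) : X.carrier → X.carrier :=
  (X.mapsTo 1).restrict (SymbolicDynamics.FullShift.shift 1) X.carrier X.carrier

/-- The language of `X`: all finite words that appear in points of `X`. -/
def language (X : Subshift (Fin p) I) : Set (List (Fin p)) :=
  {w | ∃ x ∈ X.carrier, ∃ i : I, ∀ (k : ℕ) (hk : k < w.length), x (i + (k : I)) = w[k]}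

/-- The cylinder of points of `X` that show the word `w` in the places `0, …, |w| - 1`. -/
def cylinder (X : Subshift (Fin p) I) (w : List (Fin p)) : Set X.carrier :=
  {x | ∀ (k : ℕ) (hk : k < w.length), x.1 (k : I) = w[k]}

/-- The topological entropy of the shift map on `X` (Bowen's definition through dynamical covers),
for the uniform structure on `X` induced by the product of the discrete ones on the alphabet. -/
def topEntropy (X : Subshift (Fin p) I) : EReal :=
  letI : UniformSpace (Fin p) := ⊥
  Dynamics.coverEntropy (shiftMap X) (Set.univ : Set X.carrier)

/-- (Per)-specification on `G` with gap size `t`: the connecting words can be chosen so that the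
cylinder of the resulting word `x` moreover contains a point `y` with `σ^{|x| + t} y = y`. -/
def HasPerSpecification (X : Subshift (Fin p) I) (G : Set (List (Fin p))) (t : ℕ) : Prop :=
  ∀ ws : List (List (Fin p)), ws ≠ [] → (∀ w ∈ ws, w ∈ G) →
    ∃ vs, IsGluing (language X) t ws vs ∧
      ∃ y ∈ cylinder X (glue ws vs),
        Function.IsPeriodicPt (shiftMap X) ((glue ws vs).length + t) y

/-- The set `Per(n)` of points of `X` with `σ^k x = x` for some `1 ≤ k ≤ n`. -/
def Per (X : Subshift (Fin p) I) (n : ℕ) : Set X.carrier :=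
  {x | ∃ k : ℕ, 1 ≤ k ∧ k ≤ n ∧ Function.IsPeriodicPt (shiftMap X) k x}

/-- The measure `(1 / #Per(n)) ∑_{x ∈ Per(n)} δ_x`. It is a probability measure as soon as `Per(n)`
is non-empty; the set `Per(n)` is always finite. -/
def perMeasure (X : Subshift (Fin p) I) (n : ℕ) : Measure X.carrier :=
  ((Per X n).ncard : ENNReal)⁻¹ • Measure.sum fun x : Per X n => Measure.dirac (x : X.carrier)

end Shifts

end ShiftSpace

end

/-! Let h be the exponential growth rate of the language. The argument runs in an abstract system
coded by finite windows (`WindowCoding`), so that one-sided and two-sided shifts are treated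
together. Topological entropy is at most h (`coverEntropy_le_langEntropy`), so the entropy gap makes
the weights #(Cp ∪ Cs)_n e^{-nh} summable.

Counting. Gluing words of G is injective on tuples of words of equal length, which forces #G_n ≤
e^{(n+t)h} (`ncard_layer_le_exp`). Decomposing words as uvw and summing over |u| and |w| gives #L_n
≤ C e^{nh} (`exists_ncard_layer_le`); the tail of the same series shows that at most ε e^{nh} words
of length n lie outside G(M) (`exists_ncard_layer_diff_le`). As #L_n ≥ e^{nh} by subadditivity,
bounded extension yields about e^{nh} words of G in each bounded range of lengths
(`exists_le_ncard_layer`).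

Existence. Orbit averages of the uniform distribution on words of length N have a weak limit μ
(`exists_gibbs`). It satisfies μ[w] ≤ C e^{-|w|h} for some constant C, hence has entropy h, and it
gives any two words of G(M), seen in succession with a bounded gap, at least their expected
probability up to a constant (`HasTwoWordBound`).

Uniqueness. If ν has entropy h, a set of n-words of ν-measure at least d has at least const(d)
e^{nh} elements, hence many elements in G(M). The two-word bound then gives μ(A₁ ∩ T^{-n} A₂) > 0
for some n whenever A₁ and A₂ are non-null for measures of full entropy
(`exists_measure_inter_preimage_pos`). Taking A₂ to be the whole space gives ν ≪ μ; taking A₂ to be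
the complement of an invariant A₁ gives ergodicity of μ. Hence ν = μ.

Periodic points. Periodic specification for single words gives #Per(n) ≥ c e^{nh}, while a cylinder
[w] contains at most about e^{(n-|w|)h} of these points. Every limit of the periodic measures thus
has the upper Gibbs bound, so entropy h, and equals μ. -/

noncomputable section

namespace ShiftSpace

/-! ### Entropy of finite partitions -/

section PartitionEntropy

variable {Y : Type*} [MeasurableSpace Y] {ι κ : Type*}

/-- All level sets of `f` are measurable. -/
def MeasurableLevels (f : Y → ι) : Prop := ∀ a, MeasurableSet (f ⁻¹' {a})

namespace MeasurableLevels

lemma preimage [Finite ι] {f : Y → ι} (hf : MeasurableLevels f) (S : Set ι) :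
    MeasurableSet (f ⁻¹' S) := by
  rw [← biUnion_of_singleton S, preimage_iUnion₂]
  exact MeasurableSet.biUnion S.to_countable fun a _ => hf a

lemma comp [Finite ι] {f : Y → ι} (hf : MeasurableLevels f) (φ : ι → κ) :
    MeasurableLevels (φ ∘ f) := fun a => by
  rw [preimage_comp]; exact hf.preimage _

lemma prodMk {f : Y → ι} {g : Y → κ} (hf : MeasurableLevels f) (hg : MeasurableLevels g) :
    MeasurableLevels fun y => (f y, g y) := fun a => by
  have : (fun y => (f y, g y)) ⁻¹' {a} = f ⁻¹' {a.1} ∩ g ⁻¹' {a.2} := by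
    ext y; simp [Prod.ext_iff]
  rw [this]; exact (hf _).inter (hg _)

lemma pi {n : ℕ} {f : Fin n → Y → ι} (hf : ∀ i, MeasurableLevels (f i)) :
    MeasurableLevels fun y i => f i y := fun a => by
  have : (fun y i => f i y) ⁻¹' {a} = ⋂ i, f i ⁻¹' {a i} := by
    ext y; simp [funext_iff]
  rw [this]; exact MeasurableSet.iInter fun i => hf i _

lemma comp_measurable {f : Y → ι} (hf : MeasurableLevels f) {T : Y → Y} (hT : Measurable T) :
    MeasurableLevels (f ∘ T) := fun a => by
  rw [preimage_comp]; exact hT (hf a)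

lemma itinerary {T : Y → Y} (hT : Measurable T) {ξ : Y → ι} (hξ : MeasurableLevels ξ) (n : ℕ) :
    MeasurableLevels (ShiftSpace.itinerary T ξ n) :=
  MeasurableLevels.pi fun i => hξ.comp_measurable (hT.iterate i)

end MeasurableLevels

lemma negMulLog_add_le {x y : ℝ} (hx : 0 ≤ x) (hy : 0 ≤ y) :
    Real.negMulLog (x + y) ≤ Real.negMulLog x + Real.negMulLog y := by
  rcases hx.eq_or_lt with rfl | hx
  · simp
  rcases hy.eq_or_lt with rfl | hy
  · simp
  simp only [Real.negMulLog]
  have h1 := Real.log_le_log hx (by linarith : x ≤ x + y)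
  have h2 := Real.log_le_log hy (by linarith : y ≤ x + y)
  nlinarith [mul_le_mul_of_nonneg_left h1 hx.le, mul_le_mul_of_nonneg_left h2 hy.le]

lemma negMulLog_sum_le {s : Finset ι} {p : ι → ℝ} (hp : ∀ a, 0 ≤ p a) :
    Real.negMulLog (∑ a ∈ s, p a) ≤ ∑ a ∈ s, Real.negMulLog (p a) := by
  classical
  induction s using Finset.induction_on with
  | empty => simp
  | insert a s ha ih =>
    rw [Finset.sum_insert ha, Finset.sum_insert ha]
    exact (negMulLog_add_le (hp a) (Finset.sum_nonneg fun b _ => hp b)).trans (by linarith)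

/-- Gibbs' inequality for a single term. -/
lemma negMulLog_le_of_nonneg {x q : ℝ} (hx : 0 ≤ x) (hq : 0 ≤ q) (h : q = 0 → x = 0) :
    Real.negMulLog x ≤ -x * Real.log q + (q - x) := by
  rcases hx.eq_or_lt with rfl | hx
  · simpa using hq
  -- Since `Real.log 0 = 0`, the bound could fail at q = 0; the last hypothesis excludes this.
  have hq' : 0 < q := hq.lt_of_ne fun h0 => hx.ne' (h h0.symm)
  have := Real.log_le_sub_one_of_pos (div_pos hq' hx)
  rw [Real.log_div hq'.ne' hx.ne'] at this
  have h2 := mul_le_mul_of_nonneg_left this hx.le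
  have h3 : x * (q / x - 1) = q - x := by field_simp
  simp only [Real.negMulLog]
  nlinarith

/-- Among distributions of a given total mass `d` on a finite set, the uniform one has the largest
entropy. -/
lemma sum_negMulLog_le {D : Finset ι} {p : ι → ℝ} (hp : ∀ a, 0 ≤ p a) :
    ∑ a ∈ D, Real.negMulLog (p a) ≤
      Real.negMulLog (∑ a ∈ D, p a) + (∑ a ∈ D, p a) * Real.log D.card := by
  set d := ∑ a ∈ D, p a with hd
  have hd0 : 0 ≤ d := Finset.sum_nonneg fun a _ => hp a
  rcases D.eq_empty_or_nonempty with rfl | hD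
  · simp [hd]
  have hc : (0 : ℝ) < D.card := by exact_mod_cast hD.card_pos
  -- Gibbs' inequality against the uniform distribution; the error terms d / |D| - p a sum to zero.
  have key : ∀ a ∈ D, Real.negMulLog (p a) ≤ -p a * Real.log (d / D.card) + (d / D.card - p a) := by
    intro a ha
    refine negMulLog_le_of_nonneg (hp a) (by positivity) fun h => ?_
    have : d = 0 := by simpa [hc.ne'] using h
    exact (Finset.sum_eq_zero_iff_of_nonneg fun a _ => hp a).1 this a ha
  refine (Finset.sum_le_sum key).trans (le_of_eq ?_)
  rw [Finset.sum_add_distrib, ← Finset.sum_mul, Finset.sum_neg_distrib, Finset.sum_sub_distrib,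
    ← hd, Finset.sum_const, nsmul_eq_mul, mul_div_cancel₀ _ hc.ne', sub_self, add_zero]
  rcases hd0.eq_or_lt with h0 | h0
  · simp [← h0]
  · rw [Real.log_div h0.ne' hc.ne', Real.negMulLog]; ring

lemma measureReal_preimage {μ : Measure Y} [IsFiniteMeasure μ] {f : Y → ι} (hf : MeasurableLevels f)
    (S : Finset ι) : μ.real (f ⁻¹' S) = ∑ a ∈ S, μ.real (f ⁻¹' {a}) := by
  have : f ⁻¹' S = ⋃ a ∈ S, f ⁻¹' {a} := by ext; simp
  rw [this, measureReal_biUnion_finset _ fun a _ => hf a]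
  intro a _ b _ hab
  exact Disjoint.preimage f (by simpa using hab)

variable [Fintype ι] [Fintype κ]

lemma sum_measureReal_levels {μ : Measure Y} [IsProbabilityMeasure μ] {f : Y → ι}
    (hf : MeasurableLevels f) : ∑ a, μ.real (f ⁻¹' {a}) = 1 := by
  rw [← measureReal_preimage hf]; simp

lemma partitionEntropy_nonneg (μ : Measure Y) [IsProbabilityMeasure μ] (f : Y → ι) :
    0 ≤ partitionEntropy μ f :=
  Finset.sum_nonneg fun _ _ => Real.negMulLog_nonneg measureReal_nonneg measureReal_le_one

lemma partitionEntropy_comp_le (μ : Measure Y) [IsProbabilityMeasure μ] {f : Y → ι}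
    (hf : MeasurableLevels f) (φ : ι → κ) :
    partitionEntropy μ (φ ∘ f) ≤ partitionEntropy μ f := by
  classical
  unfold partitionEntropy
  rw [← Finset.sum_fiberwise Finset.univ φ]
  refine Finset.sum_le_sum fun b _ => ?_
  refine le_trans (le_of_eq ?_) (negMulLog_sum_le fun a => measureReal_nonneg)
  rw [← measureReal_preimage hf]
  congr 2
  ext y; simp

/-- Gibbs' inequality compares the joint distribution with the product of its marginals. Both have
total mass one, so the error terms cancel, and the logarithm of the product splits into the two
marginal entropies. -/
lemma partitionEntropy_prodMk_le (μ : Measure Y) [IsProbabilityMeasure μ] {f : Y → ι} {g : Y → κ}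
    (hf : MeasurableLevels f) (hg : MeasurableLevels g) :
    partitionEntropy μ (fun y => (f y, g y)) ≤ partitionEntropy μ f + partitionEntropy μ g := by
  classical
  have hfg := hf.prodMk hg
  set r : ι × κ → ℝ := fun c => μ.real ((fun y => (f y, g y)) ⁻¹' {c}) with hr
  set p : ι → ℝ := fun a => μ.real (f ⁻¹' {a})
  set q : κ → ℝ := fun b => μ.real (g ⁻¹' {b})
  have hp : ∀ a, p a = ∑ b, r (a, b) := fun a => by
    have h1 : f ⁻¹' {a} = (fun y => (f y, g y)) ⁻¹' ({a} ×ˢ Finset.univ : Finset (ι × κ)) := by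
      ext; simp [eq_comm]
    simp only [p, h1, measureReal_preimage hfg, Finset.sum_product, Finset.sum_singleton, r]
  have hq : ∀ b, q b = ∑ a, r (a, b) := fun b => by
    have h1 : g ⁻¹' {b} = (fun y => (f y, g y)) ⁻¹' (Finset.univ ×ˢ {b} : Finset (ι × κ)) := by
      ext; simp [eq_comm]
    simp only [q, h1, measureReal_preimage hfg, Finset.sum_product, Finset.sum_singleton, r]
  have hr0 : ∀ c, 0 ≤ r c := fun c => measureReal_nonneg
  have hp0 : ∀ c, 0 ≤ p c := fun c => measureReal_nonneg
  have hq0 : ∀ c, 0 ≤ q c := fun c => measureReal_nonneg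
  have hrp : ∀ a b, r (a, b) ≤ p a := fun a b => by
    rw [hp]; exact Finset.single_le_sum (fun b _ => hr0 (a, b)) (Finset.mem_univ b)
  have hrq : ∀ a b, r (a, b) ≤ q b := fun a b => by
    rw [hq]; exact Finset.single_le_sum (f := fun a => r (a, b)) (fun a _ => hr0 (a, b))
      (Finset.mem_univ a)
  have key : ∀ c : ι × κ, Real.negMulLog (r c) ≤
      (-r c * Real.log (p c.1) + -r c * Real.log (q c.2)) + (p c.1 * q c.2 - r c) := by
    rintro ⟨a, b⟩
    refine (negMulLog_le_of_nonneg (hr0 _) (mul_nonneg (hp0 a) (hq0 b)) fun h => ?_).trans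
      (le_of_eq ?_)
    · rcases mul_eq_zero.1 h with h | h
      · exact le_antisymm (h ▸ hrp a b) (hr0 _)
      · exact le_antisymm (h ▸ hrq a b) (hr0 _)
    · rcases eq_or_ne (p a) 0 with h | h
      · have : r (a, b) = 0 := le_antisymm (h ▸ hrp a b) (hr0 _)
        simp [this]
      rcases eq_or_ne (q b) 0 with h' | h'
      · have : r (a, b) = 0 := le_antisymm (h' ▸ hrq a b) (hr0 _)
        simp [this]
      · rw [Real.log_mul h h']; ring
  have hsum : ∑ c, r c = 1 := sum_measureReal_levels hfg
  have hpq : ∑ c : ι × κ, p c.1 * q c.2 = 1 := by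
    rw [Fintype.sum_prod_type, ← Finset.sum_mul_sum, sum_measureReal_levels hf,
      sum_measureReal_levels hg, one_mul]
  refine (Finset.sum_le_sum fun c _ => key c).trans (le_of_eq ?_)
  rw [Finset.sum_add_distrib, Finset.sum_sub_distrib, hsum, hpq, sub_self, add_zero,
    Finset.sum_add_distrib]
  congr 1
  · rw [Fintype.sum_prod_type]
    refine Finset.sum_congr rfl fun a _ => ?_
    simp only [← Finset.sum_mul, Finset.sum_neg_distrib]
    rw [← hp, Real.negMulLog]
  · rw [Fintype.sum_prod_type_right]
    refine Finset.sum_congr rfl fun b _ => ?_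
    simp only [← Finset.sum_mul, Finset.sum_neg_distrib]
    rw [← hq, Real.negMulLog]

lemma partitionEntropy_comp_measurePreserving {μ : Measure Y} {T : Y → Y}
    (hT : MeasurePreserving T μ μ) {f : Y → ι} (hf : MeasurableLevels f) :
    partitionEntropy μ (f ∘ T) = partitionEntropy μ f := by
  unfold partitionEntropy
  refine Finset.sum_congr rfl fun a _ => ?_
  rw [preimage_comp, hT.measureReal_preimage (hf a).nullMeasurableSet]

lemma partitionEntropy_le_log_card {μ : Measure Y} [IsProbabilityMeasure μ] {f : Y → ι}
    (hf : MeasurableLevels f) {S : Finset ι} (hS : ∀ y, f y ∈ S) :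
    partitionEntropy μ f ≤ Real.log S.card := by
  classical
  have h1 : partitionEntropy μ f = ∑ a ∈ S, Real.negMulLog (μ.real (f ⁻¹' {a})) := by
    refine (Finset.sum_subset (Finset.subset_univ S) fun a _ ha => ?_).symm
    have : f ⁻¹' {a} = ∅ := by
      ext y; simp only [mem_preimage, mem_singleton_iff, mem_empty_iff_false, iff_false]
      rintro rfl; exact ha (hS y)
    simp [this]
  have h2 : ∑ a ∈ S, μ.real (f ⁻¹' {a}) = 1 := by
    rw [← measureReal_preimage hf]
    have : f ⁻¹' (S : Set ι) = univ := by ext y; simpa using hS y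
    simp [this]
  rw [h1]
  refine (sum_negMulLog_le fun a => measureReal_nonneg).trans ?_
  simp [h2]

lemma negMulLog_le_one_sub {x : ℝ} (hx : 0 ≤ x) : Real.negMulLog x ≤ 1 - x := by
  simpa using negMulLog_le_of_nonneg hx zero_le_one (by simp)

/-- Splitting the values of `f` into `D` and its complement in the range `S` of `f`. -/
lemma partitionEntropy_le_split [DecidableEq ι] {μ : Measure Y} [IsProbabilityMeasure μ] {f : Y → ι}
    (hf : MeasurableLevels f) {S D : Finset ι} (hS : ∀ y, f y ∈ S) (hD : D ⊆ S) :
    partitionEntropy μ f ≤ 1 + μ.real (f ⁻¹' D) * Real.log D.card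
      + (1 - μ.real (f ⁻¹' D)) * Real.log S.card := by
  have h1 : partitionEntropy μ f = ∑ a ∈ S, Real.negMulLog (μ.real (f ⁻¹' {a})) := by
    refine (Finset.sum_subset (Finset.subset_univ S) fun a _ ha => ?_).symm
    have : f ⁻¹' {a} = ∅ := by
      ext y; simp only [mem_preimage, mem_singleton_iff, mem_empty_iff_false, iff_false]
      rintro rfl; exact ha (hS y)
    simp [this]
  have h2 : ∑ a ∈ S, μ.real (f ⁻¹' {a}) = 1 := by
    rw [← measureReal_preimage hf]
    have : f ⁻¹' (S : Set ι) = univ := by ext y; simpa using hS y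
    simp [this]
  rw [← Finset.sum_sdiff hD] at h1 h2
  rw [measureReal_preimage hf, h1]
  set d := ∑ a ∈ D, μ.real (f ⁻¹' {a})
  have hd0 : 0 ≤ d := Finset.sum_nonneg fun _ _ => measureReal_nonneg
  have hd1 : ∑ a ∈ S \ D, μ.real (f ⁻¹' {a}) = 1 - d := by linarith
  have hd2 : 0 ≤ 1 - d := hd1 ▸ Finset.sum_nonneg fun _ _ => measureReal_nonneg
  have e1 := sum_negMulLog_le (D := D) (p := fun a => μ.real (f ⁻¹' {a}))
    fun a => measureReal_nonneg
  have e2 := sum_negMulLog_le (D := S \ D) (p := fun a => μ.real (f ⁻¹' {a}))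
    fun a => measureReal_nonneg
  simp only [hd1] at e2
  -- The two bounds add up to 1: this is the additive constant that pays for the entropy of the
  -- choice between `D` and its complement.
  have e3 := negMulLog_le_one_sub hd0
  have e4 := negMulLog_le_one_sub hd2
  have e5 : Real.log (S \ D).card ≤ Real.log S.card := by
    rcases (S \ D).eq_empty_or_nonempty with h | h
    · rw [h]; simpa using Real.log_natCast_nonneg _
    · exact Real.log_le_log (by exact_mod_cast h.card_pos)
        (by exact_mod_cast Finset.card_le_card Finset.sdiff_subset)
  have e6 := mul_le_mul_of_nonneg_left e5 hd2
  linarith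

end PartitionEntropy

/-! ### Entropy along an orbit -/

section Rate

lemma itinerary_add {Y ι : Type*} (T : Y → Y) (ξ : Y → ι) (m n : ℕ) (y : Y) :
    itinerary T ξ (m + n) y =
      Fin.append (itinerary T ξ m y) (itinerary T ξ n (T^[m] y)) := by
  funext i
  refine Fin.addCases (fun i => ?_) (fun i => ?_) i
  · simp [itinerary]
  · simp [itinerary, ← Function.iterate_add_apply, add_comm]

variable {Y : Type*} [MeasurableSpace Y] {ι κ : Type*} [Fintype ι] [Fintype κ]

lemma partitionEntropy_itinerary_add {T : Y → Y} {μ : Measure Y} [IsProbabilityMeasure μ]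
    (hT : MeasurePreserving T μ μ) {ξ : Y → ι} (hξ : MeasurableLevels ξ) (m n : ℕ) :
    partitionEntropy μ (itinerary T ξ (m + n)) ≤
      partitionEntropy μ (itinerary T ξ m) + partitionEntropy μ (itinerary T ξ n) := by
  have h1 : itinerary T ξ (m + n) = (fun c : (Fin m → ι) × (Fin n → ι) => Fin.append c.1 c.2) ∘
      fun y => (itinerary T ξ m y, (itinerary T ξ n ∘ T^[m]) y) := by
    funext y; exact itinerary_add T ξ m n y
  have hm := hξ.itinerary hT.measurable m
  have hn := hξ.itinerary hT.measurable n
  rw [h1]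
  refine (partitionEntropy_comp_le μ (hm.prodMk (hn.comp_measurable (hT.measurable.iterate m)))
    _).trans ?_
  refine (partitionEntropy_prodMk_le μ hm (hn.comp_measurable (hT.measurable.iterate m))).trans ?_
  rw [partitionEntropy_comp_measurePreserving (hT.iterate m) hn]

lemma partitionEntropy_itinerary_le {T : Y → Y} {μ : Measure Y} [IsProbabilityMeasure μ]
    (hT : MeasurePreserving T μ μ) {ξ : Y → ι} (hξ : MeasurableLevels ξ) (n : ℕ) :
    partitionEntropy μ (itinerary T ξ n) ≤ n * partitionEntropy μ ξ := by
  have h1 : partitionEntropy μ (itinerary T ξ 1) ≤ partitionEntropy μ ξ :=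
    have h : itinerary T ξ 1 = (fun a (_ : Fin 1) => a) ∘ ξ := by
      funext y i; simp [itinerary]
    h ▸ partitionEntropy_comp_le μ hξ _
  induction n with
  | zero =>
    refine (partitionEntropy_le_log_card (S := Finset.univ) (hξ.itinerary hT.measurable 0)
      fun _ => Finset.mem_univ _).trans ?_
    simp
  | succ n ih =>
    refine (partitionEntropy_itinerary_add hT hξ n 1).trans ?_
    push_cast; linarith

lemma subadditive_partitionEntropy {T : Y → Y} {μ : Measure Y} [IsProbabilityMeasure μ]
    (hT : MeasurePreserving T μ μ) {ξ : Y → ι} (hξ : MeasurableLevels ξ) :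
    Subadditive fun n => partitionEntropy μ (itinerary T ξ n) :=
  fun m n => partitionEntropy_itinerary_add hT hξ m n

/-- For invariant measures the entropy rate is a lower bound of all `H_n / n`. -/
lemma le_partitionEntropy_of_le_entropyRate {T : Y → Y} {μ : Measure Y} [IsProbabilityMeasure μ]
    (hT : MeasurePreserving T μ μ) {ξ : Y → ι} (hξ : MeasurableLevels ξ) {h : ℝ}
    (hh : (h : EReal) ≤ entropyRate T μ ξ) (n : ℕ) :
    n * h ≤ partitionEntropy μ (itinerary T ξ n) := by
  have hs := subadditive_partitionEntropy hT hξ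
  have hb : BddBelow (range fun n : ℕ => partitionEntropy μ (itinerary T ξ n) / n) :=
    ⟨0, by rintro _ ⟨n, rfl⟩; exact div_nonneg (partitionEntropy_nonneg _ _) n.cast_nonneg⟩
  have h1 : entropyRate T μ ξ = (hs.lim : EReal) :=
    ((continuous_coe_real_ereal.tendsto _).comp (hs.tendsto_lim hb)).limsup_eq
  rw [h1, EReal.coe_le_coe_iff] at hh
  rcases eq_or_ne n 0 with rfl | hn
  · simpa using partitionEntropy_nonneg μ _
  have h2 := hh.trans (hs.lim_le_div hb hn)
  rwa [le_div_iff₀ (by positivity), mul_comm] at h2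

lemma le_entropyRate_of_forall {T : Y → Y} {μ : Measure Y} {ξ : Y → ι} {h C : ℝ}
    (hC : ∀ n : ℕ, n * h - C ≤ partitionEntropy μ (itinerary T ξ n)) :
    h ≤ entropyRate T μ ξ := by
  have h1 : Tendsto (fun n : ℕ => ((h - C / n : ℝ) : EReal)) atTop (𝓝 (h : EReal)) := by
    refine (continuous_coe_real_ereal.tendsto _).comp ?_
    simpa using (tendsto_const_nhds (x := h)).sub (tendsto_const_div_atTop_nhds_zero_nat C)
  rw [← h1.limsup_eq]
  refine limsup_le_limsup ?_
  filter_upwards [eventually_gt_atTop 0] with n hn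
  rw [EReal.coe_le_coe_iff]
  have : (0 : ℝ) < n := by exact_mod_cast hn
  calc h - C / n = (n * h - C) / n := by field_simp
    _ ≤ _ := by gcongr; exact hC n

/-- If `ξ` is determined by `η` and `ζ`, then the entropy of `ζ` bounds how much the entropy of the
itineraries of `ξ` exceeds that of the itineraries of `η`. -/
lemma partitionEntropy_itinerary_le_add {θ : Type*} [Fintype θ] {T : Y → Y} {μ : Measure Y}
    [IsProbabilityMeasure μ] (hT : MeasurePreserving T μ μ) {ξ : Y → ι} {η : Y → κ} {ζ : Y → θ}
    (hη : MeasurableLevels η) (hζ : MeasurableLevels ζ) (φ : κ → θ → ι)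
    (h : ∀ y, ξ y = φ (η y) (ζ y)) (n : ℕ) :
    partitionEntropy μ (itinerary T ξ n) ≤
      partitionEntropy μ (itinerary T η n) + n * partitionEntropy μ ζ := by
  have h1 : itinerary T ξ n = (fun c : (Fin n → κ) × (Fin n → θ) => fun i => φ (c.1 i) (c.2 i)) ∘
      fun y => (itinerary T η n y, itinerary T ζ n y) := by
    funext y i; exact h _
  have hm := hη.itinerary hT.measurable n
  have hn := hζ.itinerary hT.measurable n
  rw [h1]
  refine (partitionEntropy_comp_le μ (hm.prodMk hn) _).trans ?_
  refine (partitionEntropy_prodMk_le μ hm hn).trans ?_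
  gcongr
  exact partitionEntropy_itinerary_le hT hζ n

end Rate

/-! ### Words of an orbit coding -/

section Coding

variable {Y A : Type*}

/-- The word `ξ(y) ξ(T y) ⋯ ξ(T^{n-1} y)`. -/
def word (T : Y → Y) (ξ : Y → A) (n : ℕ) (y : Y) : List A := List.ofFn (itinerary T ξ n y)

/-- The points whose coding starts with the word `w`. -/
def cyl (T : Y → Y) (ξ : Y → A) (w : List A) : Set Y := {y | word T ξ w.length y = w}

/-- The words that occur in the coding of some point. -/
def lang (T : Y → Y) (ξ : Y → A) : Set (List A) := {w | (cyl T ξ w).Nonempty}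

/-- The words of length `n` of a collection. -/
def layer (D : Set (List A)) (n : ℕ) : Set (List A) := {w ∈ D | w.length = n}

/-- The number of words of length `n` seen from points of `B`. -/
def count (T : Y → Y) (ξ : Y → A) (n : ℕ) (B : Set Y) : ℕ := (word T ξ n '' B).ncard

variable (T : Y → Y) (ξ : Y → A)

@[simp] lemma length_word (n : ℕ) (y : Y) : (word T ξ n y).length = n := by simp [word]

lemma word_add (m n : ℕ) (y : Y) :
    word T ξ (m + n) y = word T ξ m y ++ word T ξ n (T^[m] y) := by
  rw [word, itinerary_add, List.ofFn_fin_append]; rfl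

lemma mem_cyl_append {u v : List A} {y : Y} :
    y ∈ cyl T ξ (u ++ v) ↔ y ∈ cyl T ξ u ∧ T^[u.length] y ∈ cyl T ξ v := by
  simp only [cyl, mem_ofPred_eq, List.length_append, word_add]
  exact ⟨fun h => List.append_inj h (by simp), fun h => by rw [h.1, h.2]⟩

lemma word_mem_lang (n : ℕ) (y : Y) : word T ξ n y ∈ lang T ξ := ⟨y, by simp [cyl]⟩

lemma word_image_univ (n : ℕ) : word T ξ n '' univ = layer (lang T ξ) n := by
  ext w; constructor
  · rintro ⟨y, -, rfl⟩; exact ⟨word_mem_lang T ξ n y, by simp⟩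
  · rintro ⟨⟨y, hy⟩, rfl⟩; exact ⟨y, trivial, hy⟩

lemma cyl_subset_of_length {n : ℕ} {w : List A} (hw : w.length = n) :
    cyl T ξ w = word T ξ n ⁻¹' {w} := by subst hw; rfl

lemma count_univ (n : ℕ) : count T ξ n univ = (layer (lang T ξ) n).ncard := by
  rw [count, word_image_univ]

lemma bddBelow_log_count_div :
    BddBelow (range fun n : ℕ => Real.log (count T ξ n univ) / n) :=
  ⟨0, by rintro _ ⟨n, rfl⟩; exact div_nonneg (Real.log_natCast_nonneg _) n.cast_nonneg⟩

variable [Finite A]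

lemma finite_layer (D : Set (List A)) (n : ℕ) : (layer D n).Finite :=
  (List.finite_length_eq A n).subset fun _ h => h.2

lemma finite_word_image (n : ℕ) (B : Set Y) : (word T ξ n '' B).Finite :=
  (List.finite_length_eq A n).subset (by rintro _ ⟨y, -, rfl⟩; simp)

lemma layer_ncard_mono {D E : Set (List A)} (h : D ⊆ E) (n : ℕ) :
    (layer D n).ncard ≤ (layer E n).ncard :=
  ncard_le_ncard (fun _ hw => ⟨h hw.1, hw.2⟩) (finite_layer E n)

lemma count_mono {B C : Set Y} (h : B ⊆ C) (n : ℕ) : count T ξ n B ≤ count T ξ n C :=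
  ncard_le_ncard (image_mono h) (finite_word_image T ξ n C)

lemma count_add_le (m n : ℕ) (B C : Set Y) :
    count T ξ (m + n) (B ∩ T^[m] ⁻¹' C) ≤ count T ξ m B * count T ξ n C := by
  have h : word T ξ (m + n) '' (B ∩ T^[m] ⁻¹' C) ⊆
      (fun p : List A × List A => p.1 ++ p.2) '' ((word T ξ m '' B) ×ˢ (word T ξ n '' C)) := by
    rintro _ ⟨y, ⟨hB, hC⟩, rfl⟩
    exact ⟨(word T ξ m y, word T ξ n (T^[m] y)), ⟨⟨y, hB, rfl⟩, ⟨_, hC, rfl⟩⟩,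
      (word_add T ξ m n y).symm⟩
  have hf := (finite_word_image T ξ m B).prod (finite_word_image T ξ n C)
  calc _ ≤ _ := ncard_le_ncard h (hf.image _)
    _ ≤ _ := ncard_image_le hf
    _ = _ := ncard_prod

lemma count_pos [Nonempty Y] (n : ℕ) : 0 < count T ξ n univ :=
  (ncard_pos (finite_word_image T ξ n univ)).2 (univ_nonempty.image _)

lemma subadditive_log_count [Nonempty Y] : Subadditive fun n => Real.log (count T ξ n univ) := by
  intro m n
  rw [← Real.log_mul (by exact_mod_cast (count_pos T ξ m).ne')
    (by exact_mod_cast (count_pos T ξ n).ne')]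
  refine Real.log_le_log (by exact_mod_cast count_pos T ξ _) ?_
  have := count_add_le T ξ m n univ univ
  simp only [preimage_univ, inter_univ] at this
  exact_mod_cast this

/-- The exponential growth rate of the number of words of length `n`. -/
def langEntropy [Nonempty Y] : ℝ := (subadditive_log_count T ξ).lim

lemma tendsto_log_count_div [Nonempty Y] :
    Tendsto (fun n : ℕ => Real.log (count T ξ n univ) / n) atTop (𝓝 (langEntropy T ξ)) :=
  (subadditive_log_count T ξ).tendsto_lim (bddBelow_log_count_div T ξ)

lemma langEntropy_nonneg [Nonempty Y] : 0 ≤ langEntropy T ξ :=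
  ge_of_tendsto' (tendsto_log_count_div T ξ) fun n =>
    div_nonneg (Real.log_natCast_nonneg _) n.cast_nonneg

lemma exp_le_count [Nonempty Y] (n : ℕ) :
    Real.exp (n * langEntropy T ξ) ≤ count T ξ n univ := by
  rw [← Real.le_log_iff_exp_le (by exact_mod_cast count_pos T ξ n)]
  rcases eq_or_ne n 0 with rfl | hn
  · simpa using Real.log_natCast_nonneg _
  have := (subadditive_log_count T ξ).lim_le_div (bddBelow_log_count_div T ξ) hn
  rw [le_div_iff₀ (by positivity), mul_comm] at this
  exact this

lemma exists_count_le_exp [Nonempty Y] {ε : ℝ} (hε : 0 < ε) :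
    ∃ C > 0, ∀ n : ℕ, (count T ξ n univ : ℝ) ≤ C * Real.exp (n * (langEntropy T ξ + ε)) := by
  have h1 : ∀ᶠ n : ℕ in atTop, (count T ξ n univ : ℝ) ≤ Real.exp (n * (langEntropy T ξ + ε)) := by
    filter_upwards [(tendsto_log_count_div T ξ).eventually_lt_const (lt_add_of_pos_right _ hε),
      eventually_gt_atTop 0] with n hn hn0
    have : (0 : ℝ) < n := by exact_mod_cast hn0
    rw [div_lt_iff₀ this, mul_comm] at hn
    exact (Real.log_le_iff_le_exp (by exact_mod_cast count_pos T ξ n)).1 hn.le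
  obtain ⟨N, hN⟩ := eventually_atTop.1 h1
  -- The sum absorbs the finitely many lengths below N, where the exponential bound may fail.
  refine ⟨1 + ∑ n ∈ Finset.range N, (count T ξ n univ : ℝ), by positivity, fun n => ?_⟩
  have hS : 0 ≤ ∑ n ∈ Finset.range N, (count T ξ n univ : ℝ) := by positivity
  rcases lt_or_ge n N with h | h
  · have h2 : (count T ξ n univ : ℝ) ≤ ∑ n ∈ Finset.range N, (count T ξ n univ : ℝ) :=
      Finset.single_le_sum (f := fun n => (count T ξ n univ : ℝ)) (fun _ _ => by positivity)
        (Finset.mem_range.2 h)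
    have h3 : 1 ≤ Real.exp (n * (langEntropy T ξ + ε)) :=
      Real.one_le_exp (mul_nonneg n.cast_nonneg (add_nonneg (langEntropy_nonneg T ξ) hε.le))
    nlinarith
  · have := Real.exp_pos (n * (langEntropy T ξ + ε))
    nlinarith [hN n h]

end Coding

/-! ### Gluing words of equal length -/

section Glue

variable {A : Type*}

/-- Adding a virtual last gap makes every word come with one gap and avoids truncated subtraction.
-/
lemma length_glue {n t : ℕ} : ∀ {ws vs : List (List A)}, (∀ w ∈ ws, w.length = n) →
    (∀ v ∈ vs, v.length = t) → vs.length + 1 = ws.length →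
    (glue ws vs).length + t = ws.length * (n + t)
  | [], vs, _, _, h => by simp at h
  | [w], [], hw, _, _ => by simp [glue, hw w]
  | w :: w' :: ws, [], _, _, h => by simp at h
  | [w], v :: vs, _, _, h => by simp at h
  | w :: w' :: ws, v :: vs, hw, hv, h => by
    have ih := length_glue (n := n) (t := t) (ws := w' :: ws) (vs := vs)
      (fun x hx => hw x (List.mem_cons_of_mem _ hx)) (fun x hx => hv x (List.mem_cons_of_mem _ hx))
      (by simpa using h)
    have h1 := hw w (by simp)
    have h2 := hv v (by simp)
    rw [glue, List.length_append, List.length_append, h1, h2, List.length_cons, add_assoc, ih]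
    ring

/-- All blocks have prescribed lengths, so the glued word can be cut back at known positions,
whatever the connecting words are. -/
lemma glue_inj {n t : ℕ} : ∀ {ws ws' vs vs' : List (List A)}, (∀ w ∈ ws, w.length = n) →
    (∀ w ∈ ws', w.length = n) → (∀ v ∈ vs, v.length = t) → (∀ v ∈ vs', v.length = t) →
    vs.length + 1 = ws.length → vs'.length + 1 = ws'.length → ws.length = ws'.length →
    glue ws vs = glue ws' vs' → ws = ws'
  | [], _, _, _, _, _, _, _, h, _, _, _ => by simp at h
  | _, [], _, _, _, _, _, _, _, h, _, _ => by simp at h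
  | [w], [w'], [], [], _, _, _, _, _, _, _, h => by simpa [glue] using h
  | [w], _, _ :: _, _, _, _, _, _, h, _, _, _ => by simp at h
  | _, [w], _, _ :: _, _, _, _, _, _, h, _, _ => by simp at h
  | _ :: _ :: _, _, [], _, _, _, _, _, h, _, _, _ => by simp at h
  | _, _ :: _ :: _, _, [], _, _, _, _, _, h, _, _ => by simp at h
  | w :: x :: ws, w' :: x' :: ws', v :: vs, v' :: vs', hw, hw', hv, hv', h1, h1', h2, h => by
    simp only [glue, List.append_assoc] at h
    obtain ⟨e1, h⟩ := List.append_inj h ((hw w (by simp)).trans (hw' w' (by simp)).symm)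
    obtain ⟨-, h⟩ := List.append_inj h ((hv v (by simp)).trans (hv' v' (by simp)).symm)
    have := glue_inj (fun y hy => hw y (List.mem_cons_of_mem _ hy))
      (fun y hy => hw' y (List.mem_cons_of_mem _ hy))
      (fun y hy => hv y (List.mem_cons_of_mem _ hy))
      (fun y hy => hv' y (List.mem_cons_of_mem _ hy)) (by simpa using h1) (by simpa using h1')
      (by simpa using h2) h
    rw [e1, this]

end Glue

/-! ### Upper bounds for good words from specification -/

section Specification

variable {Y A : Type*} [Finite A] {T : Y → Y} {ξ : Y → A}

/-- Gluing maps (m+1)-tuples from G_n injectively to words of the language; m+1 words leave m gaps.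
-/
lemma pow_ncard_layer_le_count {G : Set (List A)} {t : ℕ}
    (hS : HasSSpecification (lang T ξ) G t) (n m : ℕ) :
    (layer G n).ncard ^ (m + 1) ≤ count T ξ ((m + 1) * n + m * t) univ := by
  have := (finite_layer G n).fintype
  have key : ∀ x : List.Vector (layer G n) (m + 1),
      ∃ vs, IsGluing (lang T ξ) t (x.1.map Subtype.val) vs := fun x => by
    refine hS _ ?_ ?_
    · intro h
      have := congrArg List.length h
      simp [x.2] at this
    · intro w hw
      obtain ⟨a, -, rfl⟩ := List.mem_map.1 hw
      exact a.2.1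
  choose vs hvs using key
  have hl : ∀ x : List.Vector (layer G n) (m + 1), ∀ w ∈ x.1.map Subtype.val, w.length = n := by
    intro x w hw
    obtain ⟨a, -, rfl⟩ := List.mem_map.1 hw
    exact a.2.2
  have h1 : (layer G n).ncard ^ (m + 1) = Nat.card (List.Vector (layer G n) (m + 1)) := by
    rw [Nat.card_eq_fintype_card, card_vector, ← Nat.card_eq_fintype_card, Nat.card_coe_set_eq]
  have := (finite_layer (lang T ξ) ((m + 1) * n + m * t)).to_subtype
  rw [h1, count_univ, ← Nat.card_coe_set_eq]
  refine Nat.card_le_card_of_injective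
    (fun x => (⟨glue (x.1.map Subtype.val) (vs x), (hvs x).2.2, ?_⟩ :
      layer (lang T ξ) ((m + 1) * n + m * t))) ?_
  · have := length_glue (hl x) (fun v hv => ((hvs x).2.1 v hv).2) (hvs x).1
    simp only [List.length_map, x.2] at this
    have e : (m + 1) * (n + t) = (m + 1) * n + m * t + t := by ring
    omega
  · intro x x' h
    have h := congrArg Subtype.val h
    have := glue_inj (hl x) (hl x') (fun v hv => ((hvs x).2.1 v hv).2)
      (fun v hv => ((hvs x').2.1 v hv).2) (hvs x).1 (hvs x').1 (by simp [x.2, x'.2]) h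
    exact Subtype.ext (List.map_injective_iff.2 Subtype.val_injective this)

lemma le_one_of_pow_succ_le {x C : ℝ} (h : ∀ m : ℕ, x ^ (m + 1) ≤ C) : x ≤ 1 := by
  by_contra! hx
  obtain ⟨m, hm⟩ := ((tendsto_pow_atTop_atTop_of_one_lt hx).eventually_gt_atTop C).exists
  have := h m
  rw [pow_succ] at this
  have h0 : 0 < x ^ m := by positivity
  nlinarith

/-- Specification bounds the number of good words of each length. -/
lemma ncard_layer_le_exp [Nonempty Y] {G : Set (List A)} {t : ℕ} (hS : HasSSpecification (lang T ξ) G t)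
    (n : ℕ) : ((layer G n).ncard : ℝ) ≤ Real.exp ((n + t) * langEntropy T ξ) := by
  set h := langEntropy T ξ
  have key : ∀ ε > 0, ((layer G n).ncard : ℝ) ≤ Real.exp ((n + t) * (h + ε)) := by
    intro ε hε
    obtain ⟨C, hC0, hC⟩ := exists_count_le_exp T ξ hε
    have h0 : 0 ≤ h := langEntropy_nonneg T ξ
    have hE := Real.exp_pos ((n + t) * (h + ε))
    rw [← div_le_one hE]
    -- The bound on the language carries an unknown constant C. Bounding all powers of the quotient
    -- by C removes it.
    refine le_one_of_pow_succ_le (C := C) fun m => ?_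
    rw [div_pow, div_le_iff₀ (by positivity), ← Real.exp_nat_mul]
    have h1 : ((layer G n).ncard : ℝ) ^ (m + 1) ≤ count T ξ ((m + 1) * n + m * t) univ := by
      exact_mod_cast pow_ncard_layer_le_count hS n m
    refine h1.trans ((hC _).trans ?_)
    refine mul_le_mul_of_nonneg_left (Real.exp_le_exp.2 ?_) hC0.le
    push_cast
    have : 0 ≤ (t : ℝ) * (h + ε) := by positivity
    nlinarith
  have hlim : Tendsto (fun ε : ℝ => Real.exp ((n + t) * (h + ε))) (𝓝[>] 0)
      (𝓝 (Real.exp ((n + t) * (h + 0)))) := by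
    refine Tendsto.mono_left (Continuous.tendsto ?_ 0) nhdsWithin_le_nhds
    fun_prop
  rw [add_zero] at hlim
  exact ge_of_tendsto hlim (eventually_mem_nhdsWithin.mono key)

end Specification

/-! ### Counting words through a decomposition of the language -/

section Decomposition

variable {A : Type*} [Finite A]

lemma ncard_append_le {Cp G Cs : Set (List A)} (i j k : ℕ) :
    {x | ∃ u ∈ layer Cp i, ∃ v ∈ layer G j, ∃ w ∈ layer Cs k, x = u ++ v ++ w}.ncard ≤
      (layer Cp i).ncard * (layer G j).ncard * (layer Cs k).ncard := by
  have h : {x | ∃ u ∈ layer Cp i, ∃ v ∈ layer G j, ∃ w ∈ layer Cs k, x = u ++ v ++ w} ⊆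
      (fun p : (List A × List A) × List A => p.1.1 ++ p.1.2 ++ p.2) ''
        ((layer Cp i ×ˢ layer G j) ×ˢ layer Cs k) := by
    rintro _ ⟨u, hu, v, hv, w, hw, rfl⟩
    exact ⟨((u, v), w), ⟨⟨hu, hv⟩, hw⟩, rfl⟩
  have hf := ((finite_layer Cp i).prod (finite_layer G j)).prod (finite_layer Cs k)
  calc _ ≤ _ := ncard_le_ncard h (hf.image _)
    _ ≤ _ := ncard_image_le hf
    _ = _ := by rw [ncard_prod, ncard_prod]

lemma ncard_biUnion_le {ι α : Type*} (s : Finset ι) (f : ι → Set α) (hf : ∀ i ∈ s, (f i).Finite) :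
    (⋃ i ∈ s, f i).ncard ≤ ∑ i ∈ s, (f i).ncard := by
  classical
  induction s using Finset.induction_on with
  | empty => simp
  | insert a s ha ih =>
    rw [Finset.set_biUnion_insert, Finset.sum_insert ha]
    exact (ncard_union_le _ _).trans (by
      gcongr; exact ih fun i hi => hf i (Finset.mem_insert_of_mem hi))

variable {L Cp G Cs : Set (List A)} {h K : ℝ}

/-- Words of length `n` that decompose with prefix and suffix lengths in `F`. -/
lemma ncard_decomposed_le (hG : ∀ n, ((layer G n).ncard : ℝ) ≤ K * Real.exp (n * h)) (hK : 0 ≤ K)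
    (n : ℕ) (F : Finset (ℕ × ℕ)) :
    ({x | x.length = n ∧ ∃ u ∈ Cp, ∃ v ∈ G, ∃ w ∈ Cs, (u.length, w.length) ∈ F ∧
        x = u ++ v ++ w}.ncard : ℝ) ≤
      K * Real.exp (n * h) * ∑ q ∈ F,
        ((layer (Cp ∪ Cs) q.1).ncard * Real.exp (-(q.1 * h))) *
        ((layer (Cp ∪ Cs) q.2).ncard * Real.exp (-(q.2 * h))) := by
  set E : ℕ × ℕ → Set (List A) := fun q => {x | x.length = n ∧ ∃ u ∈ layer Cp q.1,
    ∃ v ∈ layer G (n - q.1 - q.2), ∃ w ∈ layer Cs q.2, x = u ++ v ++ w} with hE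
  have hEf : ∀ q, (E q).Finite := fun q =>
    (List.finite_length_eq A n).subset fun x hx => hx.1
  have hsub : {x | x.length = n ∧ ∃ u ∈ Cp, ∃ v ∈ G, ∃ w ∈ Cs, (u.length, w.length) ∈ F ∧
        x = u ++ v ++ w} ⊆ ⋃ q ∈ F, E q := by
    rintro x ⟨hx, u, hu, v, hv, w, hw, hF, rfl⟩
    refine mem_biUnion hF ⟨hx, u, ⟨hu, rfl⟩, v, ⟨hv, ?_⟩, w, ⟨hw, rfl⟩, rfl⟩
    simp only [List.length_append] at hx ⊢
    omega
  have hE1 : ∀ q, ((E q).ncard : ℝ) ≤ K * Real.exp (n * h) *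
      (((layer (Cp ∪ Cs) q.1).ncard * Real.exp (-(q.1 * h))) *
        ((layer (Cp ∪ Cs) q.2).ncard * Real.exp (-(q.2 * h)))) := by
    intro q
    rcases (E q).eq_empty_or_nonempty with h0 | ⟨x, hx, u, hu, v, hv, w, hw, rfl⟩
    · rw [h0]; simp only [ncard_empty, Nat.cast_zero]; positivity
    have hlen : q.1 + (n - q.1 - q.2) + q.2 = n := by
      have := hu.2; have := hv.2; have := hw.2
      simp only [List.length_append] at hx; omega
    set j := n - q.1 - q.2
    have h1 : (E q).ncard ≤ (layer Cp q.1).ncard * (layer G j).ncard * (layer Cs q.2).ncard := by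
      refine le_trans (ncard_le_ncard (fun x hx => hx.2) ?_) (ncard_append_le _ _ _)
      refine (List.finite_length_eq A n).subset ?_
      rintro _ ⟨u, hu, v, hv, w, hw, rfl⟩
      simp [hu.2, hv.2, hw.2]; omega
    have h2 : ((layer Cp q.1).ncard : ℝ) ≤ (layer (Cp ∪ Cs) q.1).ncard := by
      exact_mod_cast layer_ncard_mono subset_union_left _
    have h3 : ((layer Cs q.2).ncard : ℝ) ≤ (layer (Cp ∪ Cs) q.2).ncard := by
      exact_mod_cast layer_ncard_mono subset_union_right _
    -- As j = n - |u| - |w|, the exponential factors into e^{nh} and one weight for each of u and w;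
    -- only e^{nh} depends on n.
    have h4 : Real.exp (j * h) = Real.exp (n * h) * Real.exp (-(q.1 * h)) *
        Real.exp (-(q.2 * h)) := by
      rw [← Real.exp_add, ← Real.exp_add, ← hlen]; push_cast; congr 1; ring
    calc ((E q).ncard : ℝ) ≤ (layer Cp q.1).ncard * (layer G j).ncard * (layer Cs q.2).ncard := by
          exact_mod_cast h1
      _ ≤ (layer (Cp ∪ Cs) q.1).ncard * (K * Real.exp (j * h)) * (layer (Cp ∪ Cs) q.2).ncard := by
          gcongr; exact hG j
      _ = _ := by rw [h4]; ring
  calc _ ≤ ((⋃ q ∈ F, E q).ncard : ℝ) := by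
        exact_mod_cast ncard_le_ncard hsub (F.finite_toSet.biUnion fun q _ => hEf q)
    _ ≤ ∑ q ∈ F, ((E q).ncard : ℝ) := by
        exact_mod_cast ncard_biUnion_le F E fun q _ => hEf q
    _ ≤ _ := by rw [Finset.mul_sum]; exact Finset.sum_le_sum fun q _ => hE1 q

/-- The sum over pairs of prefix and suffix lengths is a product of two partial sums of a convergent
series, hence bounded independently of the word length. -/
lemma exists_ncard_layer_le (hdec : IsDecomposition L Cp G Cs)
    (hG : ∀ n, ((layer G n).ncard : ℝ) ≤ K * Real.exp (n * h)) (hK : 0 ≤ K)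
    (hC : Summable fun n : ℕ => ((layer (Cp ∪ Cs) n).ncard : ℝ) * Real.exp (-(n * h))) :
    ∃ C > 0, ∀ n, ((layer L n).ncard : ℝ) ≤ C * Real.exp (n * h) := by
  set b : ℕ → ℝ := fun n => ((layer (Cp ∪ Cs) n).ncard : ℝ) * Real.exp (-(n * h)) with hb
  have hb0 : ∀ n, 0 ≤ b n := fun n => by positivity
  set s := ∑' n, b n
  have hs0 : 0 ≤ s := tsum_nonneg hb0
  refine ⟨K * (s * s) + 1, by positivity, fun n => ?_⟩
  set R := Finset.range (n + 1)
  have h1 : layer L n ⊆ {x | x.length = n ∧ ∃ u ∈ Cp, ∃ v ∈ G, ∃ w ∈ Cs,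
      (u.length, w.length) ∈ R ×ˢ R ∧ x = u ++ v ++ w} := by
    rintro x ⟨hx, hn⟩
    obtain ⟨u, hu, v, hv, w, hw, rfl⟩ := hdec.2.2.2 x hx
    refine ⟨hn, u, hu, v, hv, w, hw, ?_, rfl⟩
    simp only [List.length_append] at hn
    simp only [R, Finset.mem_product, Finset.mem_range]; omega
  have h2 := ncard_decomposed_le (Cp := Cp) (Cs := Cs) hG hK n (R ×ˢ R)
  have h3 : ∑ i ∈ R, b i ≤ s := hC.sum_le_tsum R fun n _ => hb0 n
  have h4 : ∑ q ∈ R ×ˢ R, b q.1 * b q.2 ≤ s * s := by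
    rw [Finset.sum_product, ← Finset.sum_mul_sum]
    have : 0 ≤ ∑ i ∈ R, b i := Finset.sum_nonneg fun i _ => hb0 i
    gcongr
  calc ((layer L n).ncard : ℝ) ≤ _ := by
        exact_mod_cast ncard_le_ncard h1 ((List.finite_length_eq A n).subset fun x hx => hx.1)
    _ ≤ K * Real.exp (n * h) * (s * s) := h2.trans (by gcongr)
    _ ≤ _ := by nlinarith [Real.exp_pos (n * h)]

/-- The words outside `G(M)` make up a small proportion, uniformly in their length. -/
lemma exists_ncard_layer_diff_le (hdec : IsDecomposition L Cp G Cs)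
    (hG : ∀ n, ((layer G n).ncard : ℝ) ≤ K * Real.exp (n * h)) (hK : 0 ≤ K)
    (hC : Summable fun n : ℕ => ((layer (Cp ∪ Cs) n).ncard : ℝ) * Real.exp (-(n * h)))
    {ε : ℝ} (hε : 0 < ε) :
    ∃ M, ∀ n, ((layer (L \ goodWords L Cp G Cs M) n).ncard : ℝ) ≤ ε * Real.exp (n * h) := by
  set b : ℕ → ℝ := fun n => ((layer (Cp ∪ Cs) n).ncard : ℝ) * Real.exp (-(n * h)) with hb
  have hb0 : ∀ n, 0 ≤ b n := fun n => by positivity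
  set s := ∑' n, b n
  have hs0 : 0 ≤ s := tsum_nonneg hb0
  set δ := ε / (2 * (K + 1) * (s + 1)) with hδ
  have hδ0 : 0 < δ := by positivity
  -- Beyond M = max S the weights sum to at most δ. A word outside G(M) has a prefix or a suffix
  -- longer than M, so each such word costs a factor δ; δ is chosen so that 2Ksδ ≤ ε.
  obtain ⟨S, hS⟩ := summable_iff_vanishing_norm.1 hC δ hδ0
  refine ⟨S.sup id, fun n => ?_⟩
  set M := S.sup id
  set R := Finset.range (n + 1)
  set Q := R.filter (M < ·)
  have hQ : ∑ i ∈ Q, b i ≤ δ := by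
    refine (le_abs_self _).trans (hS Q ?_).le
    rw [Finset.disjoint_left]
    intro i hi hiS
    have : i ≤ M := Finset.le_sup (f := id) hiS
    exact absurd (Finset.mem_filter.1 hi).2 (by omega)
  have h1 : layer (L \ goodWords L Cp G Cs M) n ⊆ {x | x.length = n ∧ ∃ u ∈ Cp, ∃ v ∈ G,
      ∃ w ∈ Cs, (u.length, w.length) ∈ Q ×ˢ R ∪ R ×ˢ Q ∧ x = u ++ v ++ w} := by
    rintro x ⟨⟨hx, hxM⟩, hn⟩
    obtain ⟨u, hu, v, hv, w, hw, rfl⟩ := hdec.2.2.2 x hx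
    refine ⟨hn, u, hu, v, hv, w, hw, ?_, rfl⟩
    simp only [List.length_append] at hn
    simp only [R, Q, Finset.mem_union, Finset.mem_product, Finset.mem_range, Finset.mem_filter]
    by_contra hcon
    exact hxM ⟨hx, u, hu, v, hv, w, hw, by omega, by omega, rfl⟩
  have h2 := ncard_decomposed_le (Cp := Cp) (Cs := Cs) hG hK n (Q ×ˢ R ∪ R ×ˢ Q)
  have h3 : ∑ i ∈ R, b i ≤ s := hC.sum_le_tsum R fun n _ => hb0 n
  have hR0 : 0 ≤ ∑ i ∈ R, b i := Finset.sum_nonneg fun i _ => hb0 i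
  have hQ0 : 0 ≤ ∑ i ∈ Q, b i := Finset.sum_nonneg fun i _ => hb0 i
  have h4 : ∑ q ∈ Q ×ˢ R ∪ R ×ˢ Q, b q.1 * b q.2 ≤ δ * s + s * δ := by
    have e1 : ∑ q ∈ Q ×ˢ R ∪ R ×ˢ Q, b q.1 * b q.2 ≤
        ∑ q ∈ Q ×ˢ R, b q.1 * b q.2 + ∑ q ∈ R ×ˢ Q, b q.1 * b q.2 := by
      rw [← Finset.sum_union_inter]
      exact le_add_of_nonneg_right
        (Finset.sum_nonneg fun q _ => mul_nonneg (hb0 q.1) (hb0 q.2))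
    refine e1.trans ?_
    rw [Finset.sum_product, Finset.sum_product, ← Finset.sum_mul_sum, ← Finset.sum_mul_sum]
    gcongr
  calc ((layer (L \ goodWords L Cp G Cs M) n).ncard : ℝ) ≤ _ := by
        exact_mod_cast ncard_le_ncard h1 ((List.finite_length_eq A n).subset fun x hx => hx.1)
    _ ≤ K * Real.exp (n * h) * (δ * s + s * δ) := h2.trans (by gcongr)
    _ = (K * s * (2 * δ)) * Real.exp (n * h) := by ring
    _ ≤ ε * Real.exp (n * h) := by
        gcongr
        rw [hδ, mul_div_assoc', mul_div_assoc', div_le_iff₀ (by positivity)]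
        nlinarith [mul_nonneg hK hs0, mul_nonneg hε.le hK, mul_nonneg hε.le hs0]

/-- If most words of each length lie in `G(M)`, and words of `G(M)` extend boundedly to `G`, then
`G` has many words in each window of lengths. -/
lemma exists_le_ncard_layer {M : ℕ} (hext : HasBoundedExtension L Cp G Cs)
    {c : ℝ} (hM : ∀ n : ℕ, c * Real.exp (n * h) ≤ (layer (goodWords L Cp G Cs M) n).ncard)
    (hc : 0 < c) :
    ∃ c' > 0, ∃ τ : ℕ, ∀ n : ℕ, ∃ j ≤ τ, c' * Real.exp (n * h) ≤ (layer G (n + j)).ncard := by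
  obtain ⟨τ, hτ⟩ := hext M
  -- Pigeonhole over the (τ+1)² possible pairs of extension lengths, whose sums range up to τ + τ.
  refine ⟨c / ((τ + 1) * (τ + 1)), by positivity, τ + τ, fun n => ?_⟩
  by_contra! hcon
  set R := Finset.range (τ + 1)
  set E : ℕ × ℕ → Set (List A) := fun q => {v | v.length = n ∧ ∃ u w : List A,
    u.length = q.1 ∧ w.length = q.2 ∧ u ++ v ++ w ∈ G}
  have hEf : ∀ q, (E q).Finite := fun q => (List.finite_length_eq A n).subset fun x hx => hx.1
  have h1 : layer (goodWords L Cp G Cs M) n ⊆ ⋃ q ∈ R ×ˢ R, E q := by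
    rintro v ⟨hv, hn⟩
    obtain ⟨u, w, hu, hw, h⟩ := hτ v hv
    refine mem_biUnion (x := (u.length, w.length)) ?_ ⟨hn, u, w, rfl, rfl, h⟩
    simp only [R, Finset.coe_product, mem_prod, Finset.mem_coe, Finset.mem_range]; omega
  have h2 : ∀ q, (E q).ncard ≤ (layer G (n + (q.1 + q.2))).ncard := by
    intro q
    have : E q ⊆ (fun x => (x.drop q.1).take n) '' layer G (n + (q.1 + q.2)) := by
      rintro v ⟨hv, u, w, hu, hw, h⟩
      refine ⟨u ++ v ++ w, ⟨h, by simp; omega⟩, ?_⟩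
      simp only
      rw [List.append_assoc, List.drop_left' hu, List.take_left' hv]
    exact (ncard_le_ncard this ((finite_layer _ _).image _)).trans (ncard_image_le (finite_layer _ _))
  have h3 : ((layer (goodWords L Cp G Cs M) n).ncard : ℝ) ≤
      ∑ q ∈ R ×ˢ R, ((layer G (n + (q.1 + q.2))).ncard : ℝ) := by
    have := (ncard_le_ncard h1 ((R ×ˢ R).finite_toSet.biUnion fun q _ => hEf q)).trans
      ((ncard_biUnion_le _ E fun q _ => hEf q).trans (Finset.sum_le_sum fun q _ => h2 q))
    exact_mod_cast this
  have hne : (R ×ˢ R).Nonempty := ⟨(0, 0), by simp [R]⟩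
  have h4 : ∑ q ∈ R ×ˢ R, ((layer G (n + (q.1 + q.2))).ncard : ℝ) <
      ∑ q ∈ R ×ˢ R, c / ((τ + 1) * (τ + 1)) * Real.exp (n * h) := by
    refine Finset.sum_lt_sum_of_nonempty hne fun q hq => hcon _ ?_
    simp only [R, Finset.mem_product, Finset.mem_range] at hq; omega
  rw [Finset.sum_const, Finset.card_product, Finset.card_range, nsmul_eq_mul] at h4
  push_cast at h4
  have h5 : ((τ : ℝ) + 1) * (τ + 1) * (c / ((τ + 1) * (τ + 1)) * Real.exp (n * h)) =
      c * Real.exp (n * h) := by field_simp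
  rw [h5] at h4
  exact absurd (hM n) (not_le.2 (h3.trans_lt h4))

end Decomposition

/-! ### Gluing two given words between free words -/

section TwoWords

variable {Y A : Type*} [Finite A] {T : Y → Y} {ξ : Y → A}

/-- With specification, four words of `G` of which the outer ones are free. -/
lemma mul_ncard_layer_le_count {G : Set (List A)} {t : ℕ}
    (hS : HasSSpecification (lang T ξ) G t) {x₁ x₂ : List A} (hx₁ : x₁ ∈ G) (hx₂ : x₂ ∈ G)
    (a b : ℕ) :
    (layer G a).ncard * (layer G b).ncard ≤
      count T ξ (a + t + x₁.length + t + x₂.length + t + b)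
        (T^[a + t] ⁻¹' (cyl T ξ x₁ ∩ T^[x₁.length + t] ⁻¹' cyl T ξ x₂)) := by
  set n := a + t + x₁.length + t + x₂.length + t + b with hn
  rw [← ncard_prod]
  set B := T^[a + t] ⁻¹' (cyl T ξ x₁ ∩ T^[x₁.length + t] ⁻¹' cyl T ξ x₂)
  -- The outer words u and v are recovered from the glued word because their positions are fixed.
  have h : layer G a ×ˢ layer G b ⊆
      (fun z : List A => (z.take a, z.drop (a + t + x₁.length + t + x₂.length + t))) ''
        (word T ξ n '' B) := by
    rintro ⟨u, v⟩ ⟨⟨huG, hu⟩, hvG, hv⟩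
    simp only at huG hu hvG hv
    obtain ⟨vs, hvl, hvs, y, hy⟩ := hS [u, x₁, x₂, v] (by simp) (by simp [huG, hx₁, hx₂, hvG])
    obtain ⟨c₁, c₂, c₃, rfl⟩ : ∃ c₁ c₂ c₃, vs = [c₁, c₂, c₃] :=
      List.length_eq_three.1 (by simpa using hvl)
    have hc₁ : c₁.length = t := (hvs c₁ (by simp)).2
    have hc₂ : c₂.length = t := (hvs c₂ (by simp)).2
    have hc₃ : c₃.length = t := (hvs c₃ (by simp)).2
    have hg : glue [u, x₁, x₂, v] [c₁, c₂, c₃] =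
        (u ++ c₁) ++ (x₁ ++ c₂ ++ (x₂ ++ (c₃ ++ v))) := by simp [glue]
    rw [hg] at hy
    have hy' := hy
    rw [mem_cyl_append] at hy'
    obtain ⟨-, hy₁⟩ := hy'
    rw [mem_cyl_append] at hy₁
    obtain ⟨hy₂, hy₃⟩ := hy₁
    rw [mem_cyl_append] at hy₂ hy₃
    have hlen : (u ++ c₁).length = a + t := by simp [hu, hc₁]
    have hlen₂ : (x₁ ++ c₂).length = x₁.length + t := by simp [hc₂]
    rw [hlen] at hy₂ hy₃
    rw [hlen₂] at hy₃
    have hlen₃ : ((u ++ c₁) ++ (x₁ ++ c₂ ++ (x₂ ++ (c₃ ++ v)))).length = n := by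
      simp [hu, hv, hc₁, hc₂, hc₃, hn]; ring
    rw [cyl_subset_of_length T ξ hlen₃] at hy
    refine ⟨_, ⟨y, ⟨hy₂.1, hy₃.1⟩, hy⟩, ?_⟩
    refine Prod.ext ?_ ?_
    · simp only [List.append_assoc]
      exact List.take_left' hu
    · have e : (u ++ c₁) ++ (x₁ ++ c₂ ++ (x₂ ++ (c₃ ++ v))) =
          (u ++ c₁ ++ x₁ ++ c₂ ++ x₂ ++ c₃) ++ v := by simp
      simp only [e]
      refine List.drop_left' ?_
      simp [hu, hc₁, hc₂, hc₃]; ring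
  have hf := finite_word_image T ξ n B
  exact (ncard_le_ncard h (hf.image _)).trans (ncard_image_le hf)

/-- Uniform lower bounds for the number of words of length `N` that show two given words `w₁`, `w₂`
of `G(M)` one after the other, with a gap of bounded size. -/
lemma exists_le_count_two_words {Cp G Cs : Set (List A)} {t : ℕ} {h C c : ℝ} {τ₀ : ℕ}
    (hS : HasSSpecification (lang T ξ) G t)
    (hext : HasBoundedExtension (lang T ξ) Cp G Cs) (h0 : 0 ≤ h)
    (hC : ∀ n : ℕ, (count T ξ n univ : ℝ) ≤ C * Real.exp (n * h)) (hC0 : 0 < C)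
    (hc : ∀ n : ℕ, ∃ j ≤ τ₀, c * Real.exp (n * h) ≤ (layer G (n + j)).ncard) (hc0 : 0 < c)
    (M : ℕ) :
    ∃ d > 0, ∃ J R : ℕ, ∀ w₁ ∈ goodWords (lang T ξ) Cp G Cs M,
      ∀ w₂ ∈ goodWords (lang T ξ) Cp G Cs M, ∃ j ≤ J, ∀ k ≥ t, ∀ N,
        k + w₁.length + w₂.length + R ≤ N →
        d * Real.exp ((N - w₁.length - w₂.length) * h) ≤
          count T ξ N (T^[k] ⁻¹' (cyl T ξ w₁ ∩ T^[w₁.length + j] ⁻¹' cyl T ξ w₂)) := by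
  obtain ⟨τ, hτ⟩ := hext M
  -- The factor c² counts the two free outer words, and C² pays for trimming the glued word to
  -- length N at both ends. The exponent bounds the sum of all gaps, extensions and trimmed letters;
  -- `R` leaves room after time k for both words with their gaps and extensions.
  refine ⟨c ^ 2 / (C ^ 2 * Real.exp ((2 * τ₀ + 4 * τ + 3 * t) * h)), by positivity, 2 * τ + t,
    3 * τ + 2 * t, ?_⟩
  intro w₁ hw₁ w₂ hw₂
  obtain ⟨u₁, v₁, hu₁, hv₁, hG₁⟩ := hτ w₁ hw₁
  obtain ⟨u₂, v₂, hu₂, hv₂, hG₂⟩ := hτ w₂ hw₂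
  refine ⟨v₁.length + t + u₂.length, by omega, fun k hk N hN => ?_⟩
  set j := v₁.length + t + u₂.length with hj
  obtain ⟨j₁, hj₁, hcj₁⟩ := hc (k - t)
  set r := N - (k + w₁.length + j + w₂.length + v₂.length + t) with hr
  obtain ⟨j₂, hj₂, hcj₂⟩ := hc r
  have key := mul_ncard_layer_le_count hS hG₁ hG₂ (k - t + j₁) (r + j₂)
  set B := T^[k] ⁻¹' (cyl T ξ w₁ ∩ T^[w₁.length + j] ⁻¹' cyl T ξ w₂) with hB
  set d := j₁ + u₁.length with hd
  -- The length of the free first word is k - t up to the uncontrolled j₁. Dropping d = j₁ + |u₁|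
  -- letters in front and j₂ at the end puts w₁ at time k in a word of length N.
  have hlen : k - t + j₁ + t + (u₁ ++ w₁ ++ v₁).length + t + (u₂ ++ w₂ ++ v₂).length + t + (r + j₂)
      = d + (N + j₂) := by
    simp only [List.length_append]; omega
  rw [hlen] at key
  have hsub : T^[k - t + j₁ + t] ⁻¹' (cyl T ξ (u₁ ++ w₁ ++ v₁) ∩
      T^[(u₁ ++ w₁ ++ v₁).length + t] ⁻¹' cyl T ξ (u₂ ++ w₂ ++ v₂)) ⊆
      univ ∩ T^[d] ⁻¹' (B ∩ T^[N] ⁻¹' univ) := by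
    rintro y ⟨hy₁, hy₂⟩
    refine ⟨trivial, ⟨?_, ?_⟩, trivial⟩
    · rw [List.append_assoc, mem_cyl_append, mem_cyl_append] at hy₁
      have := hy₁.2.1
      rw [← Function.iterate_add_apply] at this
      rw [← Function.iterate_add_apply]
      convert this using 2
      omega
    · rw [mem_preimage, List.append_assoc u₂, mem_cyl_append, mem_cyl_append] at hy₂
      have := hy₂.2.1
      rw [← Function.iterate_add_apply, ← Function.iterate_add_apply] at this
      rw [mem_preimage, ← Function.iterate_add_apply, ← Function.iterate_add_apply]
      convert this using 2
      simp only [List.length_append]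
      omega
  have h1 : (layer G (k - t + j₁)).ncard * (layer G (r + j₂)).ncard ≤
      count T ξ d univ * (count T ξ N B * count T ξ j₂ univ) :=
    key.trans ((count_mono T ξ hsub _).trans ((count_add_le T ξ _ _ _ _).trans
      (Nat.mul_le_mul_left _ (count_add_le T ξ _ _ _ _))))
  have h1' : ((layer G (k - t + j₁)).ncard : ℝ) * (layer G (r + j₂)).ncard ≤
      count T ξ d univ * (count T ξ N B * count T ξ j₂ univ) := by exact_mod_cast h1
  have h2 : c * Real.exp ((k - t : ℕ) * h) * (c * Real.exp (r * h)) ≤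
      C * Real.exp (d * h) * (count T ξ N B * (C * Real.exp (j₂ * h))) := by
    refine le_trans ?_ (h1'.trans ?_)
    · gcongr
    · gcongr
      · exact hC d
      · exact hC j₂
  rw [div_mul_eq_mul_div, div_le_iff₀ (by positivity)]
  have hkt : ((k - t : ℕ) : ℝ) = k - t := by push_cast [hk]; ring
  have hrN : (r : ℝ) = N - (k + w₁.length + j + w₂.length + v₂.length + t) := by
    rw [hr, Nat.cast_sub (by omega)]; push_cast; ring
  have e1 : Real.exp ((N - w₁.length - w₂.length) * h) =
      Real.exp ((k - t : ℕ) * h) * Real.exp (r * h) *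
        Real.exp ((j + v₂.length + 2 * t) * h) := by
    rw [← Real.exp_add, ← Real.exp_add, hkt, hrN]; congr 1; ring
  have hj' : (j : ℝ) ≤ 2 * τ + t := by
    have : j ≤ 2 * τ + t := by omega
    exact_mod_cast this
  have hd' : (d : ℝ) ≤ τ₀ + τ := by
    have : d ≤ τ₀ + τ := by omega
    exact_mod_cast this
  have hj₂' : (j₂ : ℝ) ≤ τ₀ := by exact_mod_cast hj₂
  have hv₂' : (v₂.length : ℝ) ≤ τ := by exact_mod_cast hv₂
  calc c ^ 2 * Real.exp ((N - w₁.length - w₂.length) * h)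
      = c * Real.exp ((k - t : ℕ) * h) * (c * Real.exp (r * h)) *
        Real.exp ((j + v₂.length + 2 * t) * h) := by rw [e1]; ring
    _ ≤ C * Real.exp (d * h) * (count T ξ N B * (C * Real.exp (j₂ * h))) *
        Real.exp ((j + v₂.length + 2 * t) * h) := by gcongr
    _ = count T ξ N B * (C ^ 2 * Real.exp ((d + j₂ + (j + v₂.length + 2 * t)) * h)) := by
        have e2 : Real.exp ((d + j₂ + (j + v₂.length + 2 * t)) * h) = Real.exp (d * h) *
            Real.exp (j₂ * h) * Real.exp ((j + v₂.length + 2 * t) * h) := by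
          rw [← Real.exp_add, ← Real.exp_add]; congr 1; ring
        rw [e2]; ring
    _ ≤ count T ξ N B * (C ^ 2 * Real.exp ((2 * τ₀ + 4 * τ + 3 * t) * h)) := by
        refine mul_le_mul_of_nonneg_left (mul_le_mul_of_nonneg_left (Real.exp_le_exp.2
          (mul_le_mul_of_nonneg_right ?_ h0)) (by positivity)) (Nat.cast_nonneg _)
        linarith

end TwoWords

/-! ### Finite windows that generate the topology -/

/-- Finite windows of the coding by `ξ` that jointly separate points. After some iterates of `T`
each window shows an initial segment of the itinerary. -/
structure WindowCoding {Y A : Type*} [TopologicalSpace Y] (T : Y → Y) (ξ : Y → A) where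
  /-- the size of the windows -/
  size : ℕ → ℕ
  /-- the number of iterates that move a window to the beginning of the itinerary -/
  offset : ℕ → ℕ
  /-- the content of the windows -/
  window : (m : ℕ) → Y → (Fin (size m) → A)
  isLocallyConstant : ∀ m, IsLocallyConstant (window m)
  window_eq_of_succ : ∀ m y z, window (m + 1) y = window (m + 1) z → window m y = window m z
  eq_of_window_eq : ∀ y z, (∀ m, window m y = window m z) → y = z
  window_iterate : ∀ m y, window m (T^[offset m] y) = itinerary T ξ (size m) y
  surjective : ∀ m, Function.Surjective T^[offset m]

namespace WindowCoding

variable {Y A : Type*} [TopologicalSpace Y] {T : Y → Y} {ξ : Y → A} (W : WindowCoding T ξ)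

/-- The points that look like a point of `K` in the `m`-th window. -/
def hull (m : ℕ) (K : Set Y) : Set Y := W.window m ⁻¹' (W.window m '' K)

lemma subset_hull (m : ℕ) (K : Set Y) : K ⊆ W.hull m K := subset_preimage_image _ _

lemma isOpen_preimage (m : ℕ) (S : Set (Fin (W.size m) → A)) : IsOpen (W.window m ⁻¹' S) :=
  W.isLocallyConstant m S

lemma isClosed_preimage (m : ℕ) (S : Set (Fin (W.size m) → A)) : IsClosed (W.window m ⁻¹' S) := by
  rw [← isOpen_compl_iff, ← preimage_compl]; exact W.isOpen_preimage m _

lemma antitone_hull (K : Set Y) : Antitone fun m => W.hull m K := by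
  refine antitone_nat_of_succ_le fun m y hy => ?_
  obtain ⟨z, hz, h⟩ := hy
  exact ⟨z, hz, W.window_eq_of_succ m z y h⟩

/-- Compactness: if every window of y agrees with that of some point of K, the nested closed sets of
such points have a common element, and it equals y because the windows separate points. -/
lemma iInter_hull [CompactSpace Y] {K : Set Y} (hK : IsClosed K) : ⋂ m, W.hull m K = K := by
  refine Subset.antisymm (fun y hy => ?_) (subset_iInter fun m => W.subset_hull m K)
  have h := IsCompact.nonempty_iInter_of_sequence_nonempty_isCompact_isClosed
    (fun m => K ∩ W.window m ⁻¹' {W.window m y})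
    (fun m z hz => ⟨hz.1, W.window_eq_of_succ m z y hz.2⟩)
    (fun m => by obtain ⟨z, hz, h⟩ := mem_iInter.1 hy m; exact ⟨z, hz, h⟩)
    ((hK.inter (W.isClosed_preimage 0 _)).isCompact)
    (fun m => hK.inter (W.isClosed_preimage m _))
  obtain ⟨z, hz⟩ := h
  rw [mem_iInter] at hz
  rw [← W.eq_of_window_eq z y fun m => (hz m).2]
  exact (hz 0).1

variable [MeasurableSpace Y]

lemma measurableSet_preimage [OpensMeasurableSpace Y] (m : ℕ) (S : Set (Fin (W.size m) → A)) :
    MeasurableSet (W.window m ⁻¹' S) := (W.isOpen_preimage m S).measurableSet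

lemma measurableSet_hull [OpensMeasurableSpace Y] (m : ℕ) (K : Set Y) :
    MeasurableSet (W.hull m K) := W.measurableSet_preimage m _

lemma measurableLevels [OpensMeasurableSpace Y] (m : ℕ) : MeasurableLevels (W.window m) :=
  fun _ => W.measurableSet_preimage m _

lemma tendsto_measureReal_hull [CompactSpace Y] [OpensMeasurableSpace Y] (μ : Measure Y)
    [IsFiniteMeasure μ] {K : Set Y} (hK : IsClosed K) :
    Tendsto (fun m => μ.real (W.hull m K)) atTop (𝓝 (μ.real K)) := by
  have := tendsto_measure_iInter_atTop (μ := μ) (s := fun m => W.hull m K)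
    (fun m => (W.measurableSet_preimage m _).nullMeasurableSet) (W.antitone_hull K)
    ⟨0, measure_ne_top μ _⟩
  rw [W.iInter_hull hK] at this
  exact (ENNReal.tendsto_toReal (measure_ne_top μ K)).comp this

/-- Finite measures are determined by the windows. -/
lemma measure_ext [CompactSpace Y] [BorelSpace Y] (W : WindowCoding T ξ) {μ ν : Measure Y}
    [IsProbabilityMeasure μ] [IsProbabilityMeasure ν]
    (h : ∀ m S, μ.real (W.window m ⁻¹' S) = ν.real (W.window m ⁻¹' S)) : μ = ν := by
  -- Closed sets form a generating π-system, and the measure of a closed set is the limit over its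
  -- hulls.
  refine ext_of_generate_finite {s : Set Y | IsClosed s} ?_ isPiSystem_isClosed ?_ (by simp)
  · rw [← borel_eq_generateFrom_isClosed]; exact BorelSpace.measurable_eq
  · intro K hK
    have h1 := W.tendsto_measureReal_hull μ hK
    have h2 := W.tendsto_measureReal_hull ν hK
    have h3 : (fun m => μ.real (W.hull m K)) = fun m => ν.real (W.hull m K) :=
      funext fun m => h m _
    rw [h3] at h1
    exact (measureReal_eq_measureReal_iff).1 (tendsto_nhds_unique h1 h2)

/-- Measurable finite partitions are approximated by functions of a window. -/
lemma exists_window_approx [CompactSpace Y] [BorelSpace Y]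
    [TopologicalSpace.PseudoMetrizableSpace Y] [Nonempty Y] {ι : Type*} [Fintype ι]
    (μ : Measure Y) [IsProbabilityMeasure μ] {ζ : Y → ι} (hζ : MeasurableLevels ζ)
    {ε : ℝ} (hε : 0 < ε) :
    ∃ m, ∃ φ : (Fin (W.size m) → A) → ι, μ.real {y | ζ y ≠ φ (W.window m y)} ≤ ε := by
  classical
  set δ : ℝ := ε / (2 * (Fintype.card ι + 1)) with hδ
  have hδ0 : 0 < δ := by positivity
  have h1 : ∀ a, ∃ K ⊆ ζ ⁻¹' {a}, IsClosed K ∧ μ (ζ ⁻¹' {a} \ K) < ENNReal.ofReal δ := fun a =>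
    (hζ a).exists_isClosed_sdiff_lt (measure_ne_top _ _) (by simpa using hδ0)
  choose K hKs hKc hKm using h1
  have h2 : ∀ᶠ m in atTop, ∀ a, μ.real (W.hull m (K a)) < μ.real (K a) + δ :=
    eventually_all.2 fun a => (W.tendsto_measureReal_hull μ (hKc a)).eventually_lt_const
      (by linarith)
  obtain ⟨m, hm⟩ := h2.exists
  obtain ⟨y₀⟩ := ‹Nonempty Y›
  -- A window value is assigned to any level whose closed core shows it. Errors occur only outside
  -- the core of the true level, or in the hull of a core but outside that core; the default value
  -- is irrelevant.
  refine ⟨m, fun c => if h : ∃ a, c ∈ W.window m '' K a then h.choose else ζ y₀, ?_⟩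
  have hsub : {y | ζ y ≠ (fun c => if h : ∃ a, c ∈ W.window m '' K a then h.choose else ζ y₀)
      (W.window m y)} ⊆ ⋃ a, ((ζ ⁻¹' {a} \ K a) ∪ (W.hull m (K a) \ K a)) := by
    intro y hy
    simp only [mem_ofPred_eq] at hy
    rw [mem_iUnion]
    by_cases hyK : y ∈ K (ζ y)
    · have hex : ∃ a, W.window m y ∈ W.window m '' K a := ⟨ζ y, y, hyK, rfl⟩
      rw [dif_pos hex] at hy
      refine ⟨hex.choose, Or.inr ⟨hex.choose_spec, fun h => hy ?_⟩⟩
      exact hKs _ h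
    · exact ⟨ζ y, Or.inl ⟨rfl, hyK⟩⟩
  have hb : ∀ a, μ.real ((ζ ⁻¹' {a} \ K a) ∪ (W.hull m (K a) \ K a)) ≤ 2 * δ := fun a => by
    have e1 : μ.real (ζ ⁻¹' {a} \ K a) ≤ δ :=
      ENNReal.toReal_le_of_le_ofReal hδ0.le (hKm a).le
    have e2 : μ.real (W.hull m (K a) \ K a) ≤ δ := by
      rw [measureReal_sdiff (W.subset_hull m _) (hKc a).measurableSet]
      linarith [hm a]
    exact (measureReal_union_le _ _).trans (by linarith)
  calc _ ≤ μ.real (⋃ a, ((ζ ⁻¹' {a} \ K a) ∪ (W.hull m (K a) \ K a))) := measureReal_mono hsub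
    _ ≤ ∑ a, μ.real ((ζ ⁻¹' {a} \ K a) ∪ (W.hull m (K a) \ K a)) := measureReal_iUnion_fintype_le _
    _ ≤ ∑ _a : ι, 2 * δ := Finset.sum_le_sum fun a _ => hb a
    _ ≤ ε := by
      rw [Finset.sum_const, Finset.card_univ, nsmul_eq_mul, hδ, mul_div_assoc', mul_div_assoc',
        div_le_iff₀ (by positivity)]
      nlinarith

/-- The correction between a partition and an approximation by a window has small entropy. -/
lemma exists_window_correction [CompactSpace Y] [BorelSpace Y]
    [TopologicalSpace.PseudoMetrizableSpace Y] [Nonempty Y] [Finite A] {ι : Type*} [Fintype ι]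
    (μ : Measure Y) [IsProbabilityMeasure μ] {ζ : Y → ι} (hζ : MeasurableLevels ζ)
    {δ : ℝ} (hδ : 0 < δ) :
    ∃ m, ∃ φ : (Fin (W.size m) → A) → ι, ∃ θ : Y → Option ι, MeasurableLevels θ ∧
      partitionEntropy μ θ ≤ δ ∧ ∀ y, ζ y = (θ y).getD (φ (W.window m y)) := by
  classical
  -- F(d) bounds the entropy of the correction when the approximation fails with probability d. It
  -- is continuous with F(0) = 0, so a good enough approximation suffices.
  set F : ℝ → ℝ := fun d => d + (Real.negMulLog d + d * Real.log (Fintype.card ι)) with hF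
  have hFc : Continuous F := by
    have := Real.continuous_negMulLog
    fun_prop
  have hF0 : F 0 < δ := by simpa [hF] using hδ
  obtain ⟨ε, hε, hball⟩ := Metric.eventually_nhds_iff.1 (hFc.continuousAt.eventually_lt_const hF0)
  obtain ⟨m, φ, hφ⟩ := W.exists_window_approx μ hζ (half_pos hε)
  -- The correction is silent where the approximation is right and reports the true level elsewhere.
  set θ : Y → Option ι := fun y => if ζ y = φ (W.window m y) then none else some (ζ y) with hθ
  have hθm : MeasurableLevels θ := (hζ.prodMk (W.measurableLevels m)).comp
    fun c : ι × (Fin (W.size m) → A) => if c.1 = φ c.2 then none else some c.1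
  refine ⟨m, φ, θ, hθm, ?_, fun y => ?_⟩
  · set d := μ.real {y | ζ y ≠ φ (W.window m y)} with hd
    have h1 := sum_measureReal_levels (μ := μ) hθm
    rw [Fintype.sum_option] at h1
    have hnone : μ.real (θ ⁻¹' {none}) = 1 - d := by
      have e : θ ⁻¹' {none} = {y | ζ y ≠ φ (W.window m y)}ᶜ := by
        ext y; simp only [hθ, mem_preimage, mem_singleton_iff, mem_compl_iff, mem_ofPred_eq]
        split_ifs with h <;> simp [h]
      have e' : {y | ζ y ≠ φ (W.window m y)} = (θ ⁻¹' {none})ᶜ := by rw [e, compl_compl]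
      rw [hd, e', probReal_compl_eq_one_sub (hθm none)]; ring
    have h2 := sum_negMulLog_le (D := (Finset.univ : Finset ι))
      (p := fun a => μ.real (θ ⁻¹' {some a})) fun _ => measureReal_nonneg
    have hsome : ∑ a, μ.real (θ ⁻¹' {some a}) = d := by linarith
    rw [hsome, Finset.card_univ] at h2
    have h3 := negMulLog_le_one_sub (x := 1 - d) (hnone ▸ measureReal_nonneg)
    have hd0 : 0 ≤ d := measureReal_nonneg
    have h4 : F d < δ := hball (by rw [Real.dist_eq, sub_zero, abs_of_nonneg hd0]; linarith)
    rw [partitionEntropy, Fintype.sum_option, hnone]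
    simp only [hF] at h4
    linarith
  · simp only [hθ]; split_ifs with h <;> simp [h]

/-- After `offset m` iterates, n successive windows can be read off from n + `size m` letters; by
invariance these iterates do not change the entropy. The excess does not depend on n. -/
lemma partitionEntropy_itinerary_window_le [CompactSpace Y] [BorelSpace Y] [Fintype A]
    {μ : Measure Y} [IsProbabilityMeasure μ] (hT : MeasurePreserving T μ μ)
    (hξ : MeasurableLevels ξ) (m n : ℕ) :
    partitionEntropy μ (itinerary T (W.window m) n) ≤
      partitionEntropy μ (itinerary T ξ n) + partitionEntropy μ (itinerary T ξ (W.size m)) := by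
  have h1 : itinerary T (W.window m) n ∘ T^[W.offset m] =
      (fun (w : Fin (n + W.size m) → A) (i : Fin n) (j : Fin (W.size m)) =>
        w ⟨i + j, by omega⟩) ∘ itinerary T ξ (n + W.size m) := by
    funext y i j
    simp only [Function.comp_apply, itinerary]
    rw [(Function.Commute.iterate_iterate_self T i (W.offset m)).eq, W.window_iterate, itinerary,
      ← Function.iterate_add_apply, add_comm]
  rw [← partitionEntropy_comp_measurePreserving (hT.iterate (W.offset m))
    ((W.measurableLevels m).itinerary hT.measurable n), h1]
  exact (partitionEntropy_comp_le μ (hξ.itinerary hT.measurable _) _).trans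
    (partitionEntropy_itinerary_add hT hξ n _)

/-- The partition into the level sets of `ξ` generates: it realises the Kolmogorov-Sinai entropy. -/
theorem entropyRate_le (W : WindowCoding T ξ) [CompactSpace Y] [BorelSpace Y]
    [TopologicalSpace.PseudoMetrizableSpace Y] [Nonempty Y] [Fintype A] {ι : Type*} [Fintype ι]
    {μ : Measure Y} [IsProbabilityMeasure μ] (hT : MeasurePreserving T μ μ)
    (hξ : MeasurableLevels ξ) {ζ : Y → ι} (hζ : MeasurableLevels ζ) :
    entropyRate T μ ζ ≤ entropyRate T μ ξ := by
  have hs := subadditive_partitionEntropy hT hξ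
  have hb : BddBelow (range fun n : ℕ => partitionEntropy μ (itinerary T ξ n) / n) :=
    ⟨0, by rintro _ ⟨n, rfl⟩; exact div_nonneg (partitionEntropy_nonneg _ _) n.cast_nonneg⟩
  have hlim := hs.tendsto_lim hb
  have h1 : entropyRate T μ ξ = (hs.lim : EReal) :=
    ((continuous_coe_real_ereal.tendsto _).comp hlim).limsup_eq
  have key : ∀ δ > 0, entropyRate T μ ζ ≤ ((hs.lim + δ : ℝ) : EReal) := by
    intro δ hδ
    obtain ⟨m, φ, θ, hθ, hθδ, hφ⟩ := W.exists_window_correction μ hζ hδ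
    have h2 : ∀ n : ℕ, partitionEntropy μ (itinerary T ζ n) ≤
        partitionEntropy μ (itinerary T ξ n) + partitionEntropy μ (itinerary T ξ (W.size m)) +
          n * δ := fun n => by
      refine (partitionEntropy_itinerary_le_add hT (W.measurableLevels m) hθ
        (fun c o => o.getD (φ c)) hφ n).trans ?_
      gcongr
      exact W.partitionEntropy_itinerary_window_le hT hξ m n
    set C := partitionEntropy μ (itinerary T ξ (W.size m))
    have h3 : Tendsto (fun n : ℕ => (((partitionEntropy μ (itinerary T ξ n) / n) + C / n + δ : ℝ) :
        EReal)) atTop (𝓝 ((hs.lim + 0 + δ : ℝ) : EReal)) :=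
      (continuous_coe_real_ereal.tendsto _).comp
        ((hlim.add (tendsto_const_div_atTop_nhds_zero_nat C)).add_const δ)
    rw [add_zero] at h3
    rw [← h3.limsup_eq]
    refine limsup_le_limsup ?_
    filter_upwards [eventually_gt_atTop 0] with n hn
    rw [EReal.coe_le_coe_iff]
    have : (0 : ℝ) < n := by exact_mod_cast hn
    rw [div_le_iff₀ this]
    refine (h2 n).trans (le_of_eq ?_)
    field_simp
  have hlim2 : Tendsto (fun δ : ℝ => ((hs.lim + δ : ℝ) : EReal)) (𝓝[>] 0)
      (𝓝 ((hs.lim + 0 : ℝ) : EReal)) :=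
    Tendsto.mono_left ((continuous_coe_real_ereal.comp (by fun_prop)).tendsto 0) nhdsWithin_le_nhds
  rw [h1, ← add_zero hs.lim]
  exact ge_of_tendsto hlim2 (eventually_mem_nhdsWithin.mono key)

end WindowCoding

/-! ### Measures of maximal entropy -/

section MaxEntropy

lemma preimage_word {Y A : Type*} (T : Y → Y) (ξ : Y → A) (n : ℕ) (S : Set (List A)) :
    word T ξ n ⁻¹' S = itinerary T ξ n ⁻¹' (List.ofFn ⁻¹' S) := rfl

lemma count_eq_ncard_itinerary {Y A : Type*} (T : Y → Y) (ξ : Y → A) (n : ℕ) (B : Set Y) :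
    count T ξ n B = (itinerary T ξ n '' B).ncard := by
  rw [count, ← ncard_image_of_injective _ (List.ofFn_injective (α := A) (n := n)), image_image]
  rfl

variable {Y : Type*} [MeasurableSpace Y] {A : Type*} [Fintype A]
  {T : Y → Y} {ξ : Y → A}

lemma measurableSet_preimage_word (hT : Measurable T) (hξ : MeasurableLevels ξ) (n : ℕ)
    (S : Set (List A)) : MeasurableSet (word T ξ n ⁻¹' S) := by
  rw [preimage_word]; exact (hξ.itinerary hT n).preimage _

lemma partitionEntropy_itinerary_le_log_count {μ : Measure Y} [IsProbabilityMeasure μ]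
    (hT : Measurable T) (hξ : MeasurableLevels ξ) (n : ℕ) :
    partitionEntropy μ (itinerary T ξ n) ≤ Real.log (count T ξ n univ) := by
  classical
  have hf : (itinerary T ξ n '' univ).Finite := toFinite _
  rw [count_eq_ncard_itinerary, ncard_eq_toFinset_card _ hf]
  exact partitionEntropy_le_log_card (hξ.itinerary hT n) fun y => by simp

variable [Nonempty Y]

lemma entropyRate_le_langEntropy {μ : Measure Y} [IsProbabilityMeasure μ]
    (hT : Measurable T) (hξ : MeasurableLevels ξ) :
    entropyRate T μ ξ ≤ langEntropy T ξ := by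
  have h1 : Tendsto (fun n : ℕ => ((Real.log (count T ξ n univ) / n : ℝ) : EReal)) atTop
      (𝓝 (langEntropy T ξ : EReal)) :=
    (continuous_coe_real_ereal.tendsto _).comp (tendsto_log_count_div T ξ)
  rw [← h1.limsup_eq]
  refine limsup_le_limsup (Eventually.of_forall fun n => ?_)
  rw [EReal.coe_le_coe_iff]
  gcongr
  exact partitionEntropy_itinerary_le_log_count hT hξ n

/-- The upper Gibbs bound forces maximal entropy. -/
lemma langEntropy_le_entropyRate {μ : Measure Y} [IsProbabilityMeasure μ]
    (hT : Measurable T) (hξ : MeasurableLevels ξ) {K : ℝ}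
    (hK : ∀ w, μ.real (cyl T ξ w) ≤ K * Real.exp (-(w.length * langEntropy T ξ))) :
    langEntropy T ξ ≤ entropyRate T μ ξ := by
  set h := langEntropy T ξ
  refine le_entropyRate_of_forall (C := Real.log K) fun n => ?_
  have hsum := sum_measureReal_levels (μ := μ) (hξ.itinerary hT n)
  have hK' : ∀ a, μ.real (itinerary T ξ n ⁻¹' {a}) ≤ K * Real.exp (-(n * h)) := fun a => by
    have h1 : itinerary T ξ n ⁻¹' {a} = cyl T ξ (List.ofFn a) := by
      rw [cyl_subset_of_length T ξ (List.length_ofFn (f := a)), preimage_word]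
      congr 1
      ext b; simp
    have := hK (List.ofFn a)
    rwa [List.length_ofFn, ← h1] at this
  -- The information -log μ of every cylinder is at least nh - log K; averaging with the weights of
  -- the cylinders gives the entropy bound.
  have key : ∀ a, μ.real (itinerary T ξ n ⁻¹' {a}) * (n * h - Real.log K) ≤
      Real.negMulLog (μ.real (itinerary T ξ n ⁻¹' {a})) := fun a => by
    rcases (measureReal_nonneg (μ := μ) (s := itinerary T ξ n ⁻¹' {a})).eq_or_lt with h0 | h0
    · simp [← h0]
    have hKpos : 0 < K := by
      by_contra! hneg
      exact absurd (h0.trans_le (hK' a)) (not_lt.2 (mul_nonpos_of_nonpos_of_nonneg hneg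
        (Real.exp_pos _).le))
    have h1 := Real.log_le_log h0 (hK' a)
    rw [Real.log_mul hKpos.ne' (Real.exp_pos _).ne', Real.log_exp] at h1
    rw [Real.negMulLog]
    nlinarith
  calc n * h - Real.log K = ∑ a, μ.real (itinerary T ξ n ⁻¹' {a}) * (n * h - Real.log K) := by
        rw [← Finset.sum_mul, hsum, one_mul]
    _ ≤ _ := Finset.sum_le_sum fun a _ => key a

/-- For a measure of maximal entropy, sets of words of measure at least `d` are exponentially
large. -/
lemma exp_le_count_of_le_measure {μ : Measure Y} [IsProbabilityMeasure μ]
    (hT : MeasurePreserving T μ μ) (hξ : MeasurableLevels ξ)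
    (hμ : langEntropy T ξ ≤ entropyRate T μ ξ) {C : ℝ} (hC1 : 1 ≤ C)
    (hC : ∀ n : ℕ, (count T ξ n univ : ℝ) ≤ C * Real.exp (n * langEntropy T ξ))
    {d : ℝ} (hd : 0 < d) (n : ℕ) (S : Set (List A)) (hS : d ≤ μ.real (word T ξ n ⁻¹' S)) :
    Real.exp (-((1 + Real.log C) / d)) * Real.exp (n * langEntropy T ξ) ≤
      count T ξ n (word T ξ n ⁻¹' S) := by
  classical
  set h := langEntropy T ξ
  have hf : (itinerary T ξ n '' univ).Finite := toFinite _
  have hg : (itinerary T ξ n '' (word T ξ n ⁻¹' S)).Finite := toFinite _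
  have h1 := le_partitionEntropy_of_le_entropyRate hT hξ hμ n
  have h2 := partitionEntropy_le_split (μ := μ) (hξ.itinerary hT.measurable n)
    (S := hf.toFinset) (D := hg.toFinset) (fun y => by simp) (by
      rw [Finite.toFinset_subset_toFinset]; exact image_mono (subset_univ _))
  have h3 : itinerary T ξ n ⁻¹' (hg.toFinset : Set (Fin n → A)) = word T ξ n ⁻¹' S := by
    rw [Finite.coe_toFinset]
    refine Subset.antisymm ?_ (subset_preimage_image _ _)
    rintro y ⟨z, hz, hzy⟩
    rw [preimage_word, mem_preimage] at hz ⊢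
    rwa [← hzy]
  rw [h3, ← ncard_eq_toFinset_card _ hf, ← ncard_eq_toFinset_card _ hg,
    ← count_eq_ncard_itinerary, ← count_eq_ncard_itinerary] at h2
  set e := μ.real (word T ξ n ⁻¹' S)
  have he1 : e ≤ 1 := measureReal_le_one
  have hpos : 0 < count T ξ n (word T ξ n ⁻¹' S) := by
    refine (ncard_pos (finite_word_image T ξ n _)).2 (Nonempty.image _ ?_)
    by_contra hcon
    rw [not_nonempty_iff_eq_empty] at hcon
    have : e = 0 := by simp [e, hcon]
    linarith
  have h4 : Real.log (count T ξ n univ) ≤ Real.log C + n * h := by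
    have := Real.log_le_log (by exact_mod_cast count_pos T ξ n) (hC n)
    rwa [Real.log_mul (by positivity) (Real.exp_pos _).ne', Real.log_exp] at this
  rw [← Real.exp_add, ← Real.le_log_iff_exp_le (by exact_mod_cast hpos)]
  set D := Real.log (count T ξ n (word T ξ n ⁻¹' S))
  have hlC : 0 ≤ Real.log C := Real.log_nonneg hC1
  have h5 : (1 - e) * Real.log (count T ξ n univ) ≤ (1 - e) * (Real.log C + n * h) :=
    mul_le_mul_of_nonneg_left h4 (by linarith)
  -- Splitting the n-words into those of S and the rest gives nh ≤ 1 + eD + (1 - e)(log C + nh),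
  -- where e is the mass and exp D the number of words of S.
  have h6 : e * (n * h - D) ≤ 1 + Real.log C := by nlinarith
  have h7 : n * h - D ≤ (1 + Real.log C) / d := by
    rcases le_or_gt (n * h - D) 0 with h0 | h0
    · exact h0.trans (by positivity)
    · rw [le_div_iff₀ hd]; nlinarith
  linarith

/-- For measures of maximal entropy, sets of words of measure at least `d` contain many words
of `G(M)`, provided `M` is large. -/
lemma exists_le_ncard_goodWords {Cp G Cs : Set (List A)} {C : ℝ} (hC1 : 1 ≤ C)
    (hC : ∀ n : ℕ, (count T ξ n univ : ℝ) ≤ C * Real.exp (n * langEntropy T ξ))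
    (hgood : ∀ ε > 0, ∃ M, ∀ n : ℕ, ((layer (lang T ξ \ goodWords (lang T ξ) Cp G Cs M) n).ncard
      : ℝ) ≤ ε * Real.exp (n * langEntropy T ξ)) (hξ : MeasurableLevels ξ) {d : ℝ} (hd : 0 < d) :
    ∃ M, ∃ c > 0, ∀ (μ : Measure Y) [IsProbabilityMeasure μ], MeasurePreserving T μ μ →
      langEntropy T ξ ≤ entropyRate T μ ξ → ∀ (n : ℕ) (S : Set (List A)),
      d ≤ μ.real (word T ξ n ⁻¹' S) →
      c * Real.exp (n * langEntropy T ξ) ≤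
        (S ∩ layer (goodWords (lang T ξ) Cp G Cs M) n).ncard := by
  set κ := Real.exp (-((1 + Real.log C) / d)) with hκ
  have hκ0 : 0 < κ := Real.exp_pos _
  -- At least κ e^{nh} words are seen; for this M at most half of that number can be bad. Neither M
  -- nor κ depends on the measure or on S.
  obtain ⟨M, hM⟩ := hgood (κ / 2) (by positivity)
  refine ⟨M, κ / 2, by positivity, fun μ _ hT hμ n S hS => ?_⟩
  have h1 := exp_le_count_of_le_measure hT hξ hμ hC1 hC hd n S hS
  have h2 : count T ξ n (word T ξ n ⁻¹' S) ≤
      (S ∩ layer (goodWords (lang T ξ) Cp G Cs M) n).ncard +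
        (layer (lang T ξ \ goodWords (lang T ξ) Cp G Cs M) n).ncard := by
    refine (ncard_le_ncard ?_ (((finite_layer _ n).subset inter_subset_right).union
      (finite_layer _ n))).trans (ncard_union_le _ _)
    rintro _ ⟨y, hy, rfl⟩
    by_cases hg : word T ξ n y ∈ goodWords (lang T ξ) Cp G Cs M
    · exact Or.inl ⟨hy, hg, length_word T ξ n y⟩
    · exact Or.inr ⟨⟨word_mem_lang T ξ n y, hg⟩, length_word T ξ n y⟩
  have h2' : (count T ξ n (word T ξ n ⁻¹' S) : ℝ) ≤
      (S ∩ layer (goodWords (lang T ξ) Cp G Cs M) n).ncard +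
        (layer (lang T ξ \ goodWords (lang T ξ) Cp G Cs M) n).ncard := by exact_mod_cast h2
  have := hM n
  linarith

end MaxEntropy

/-- The two-word lower Gibbs bound: any two words of `G(M)` are seen one after the other, with a
bounded gap, with the expected probability. -/
def HasTwoWordBound {Y A : Type*} [MeasurableSpace Y] (T : Y → Y) (ξ : Y → A)
    (D : ℕ → Set (List A)) (h : ℝ) (μ : Measure Y) : Prop :=
  ∀ M, ∃ c > 0, ∃ J : ℕ, ∀ w₁ ∈ D M, ∀ w₂ ∈ D M, ∃ j ≤ J,
    c * Real.exp (-((w₁.length + w₂.length) * h)) ≤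
      μ.real (cyl T ξ w₁ ∩ T^[w₁.length + j] ⁻¹' cyl T ξ w₂)

/-! ### Ergodicity and uniqueness from the two-word bound -/

section KeyLemma

variable {Y : Type*} [MeasurableSpace Y] {A : Type*} [Fintype A] {T : Y → Y} {ξ : Y → A}

/-- The gap j depends on the pair of words, so each pair is charged to the sum over all gaps up to
J. For a fixed gap, the events belonging to different pairs are disjoint. -/
lemma le_sum_measureReal_of_two_words {μ : Measure Y} [IsProbabilityMeasure μ]
    (hT : Measurable T) (hξ : MeasurableLevels ξ) {h c : ℝ} {J n : ℕ} {S₁ S₂ D : Set (List A)}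
    (hD : ∀ w₁ ∈ D, ∀ w₂ ∈ D, ∃ j ≤ J,
    c * Real.exp (-((w₁.length + w₂.length) * h)) ≤
      μ.real (cyl T ξ w₁ ∩ T^[w₁.length + j] ⁻¹' cyl T ξ w₂)) :
    ((S₁ ∩ layer D n).ncard * (S₂ ∩ layer D n).ncard : ℝ) * (c * Real.exp (-((n + n) * h))) ≤
      ∑ j ∈ Finset.range (J + 1), μ.real (word T ξ n ⁻¹' S₁ ∩ T^[n + j] ⁻¹' (word T ξ n ⁻¹' S₂)) := by
  classical
  have hf₁ : (S₁ ∩ layer D n).Finite := (finite_layer D n).subset inter_subset_right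
  have hf₂ : (S₂ ∩ layer D n).Finite := (finite_layer D n).subset inter_subset_right
  set P := hf₁.toFinset ×ˢ hf₂.toFinset with hP
  set E : ℕ → List A × List A → Set Y := fun j q =>
    word T ξ n ⁻¹' {q.1} ∩ T^[n + j] ⁻¹' (word T ξ n ⁻¹' {q.2}) with hE
  have hEm : ∀ j q, MeasurableSet (E j q) := fun j q =>
    (measurableSet_preimage_word hT hξ n _).inter
      ((hT.iterate _) (measurableSet_preimage_word hT hξ n _))
  have h1 : ∀ q ∈ P, c * Real.exp (-((n + n) * h)) ≤
      ∑ j ∈ Finset.range (J + 1), μ.real (E j q) := by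
    intro q hq
    simp only [hP, Finset.mem_product, Finite.mem_toFinset] at hq
    obtain ⟨⟨-, hq₁, hl₁⟩, -, hq₂, hl₂⟩ := hq
    obtain ⟨j, hj, hb⟩ := hD q.1 hq₁ q.2 hq₂
    rw [cyl_subset_of_length T ξ hl₁, cyl_subset_of_length T ξ hl₂, hl₁, hl₂] at hb
    exact hb.trans (Finset.single_le_sum (f := fun j => μ.real (E j q))
      (fun j _ => measureReal_nonneg) (Finset.mem_range.2 (by omega)))
  have h2 : ∀ j, ∑ q ∈ P, μ.real (E j q) ≤
      μ.real (word T ξ n ⁻¹' S₁ ∩ T^[n + j] ⁻¹' (word T ξ n ⁻¹' S₂)) := by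
    intro j
    rw [← measureReal_biUnion_finset ?_ fun q _ => hEm j q]
    · refine measureReal_mono (iUnion₂_subset fun q hq => ?_)
      simp only [hP, Finset.mem_product, Finite.mem_toFinset] at hq
      rintro y ⟨hy₁, hy₂⟩
      refine ⟨?_, ?_⟩
      · rw [mem_preimage, mem_singleton_iff.1 hy₁]; exact hq.1.1
      · rw [mem_preimage, mem_preimage, mem_singleton_iff.1 hy₂]; exact hq.2.1
    · intro q _ r _ hqr
      rw [Function.onFun, Set.disjoint_left]
      rintro y ⟨hy₁, hy₂⟩ ⟨hz₁, hz₂⟩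
      exact hqr (Prod.ext (hy₁.symm.trans hz₁) (hy₂.symm.trans hz₂))
  have h3 : (P.card : ℝ) = (S₁ ∩ layer D n).ncard * (S₂ ∩ layer D n).ncard := by
    rw [hP, Finset.card_product, ncard_eq_toFinset_card _ hf₁, ncard_eq_toFinset_card _ hf₂]
    push_cast; rfl
  calc _ = ∑ q ∈ P, c * Real.exp (-((n + n) * h)) := by
        rw [Finset.sum_const, nsmul_eq_mul, h3]
    _ ≤ ∑ q ∈ P, ∑ j ∈ Finset.range (J + 1), μ.real (E j q) := Finset.sum_le_sum h1
    _ = ∑ j ∈ Finset.range (J + 1), ∑ q ∈ P, μ.real (E j q) := Finset.sum_comm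
    _ ≤ _ := Finset.sum_le_sum fun j _ => h2 j

variable [TopologicalSpace Y] [CompactSpace Y] [BorelSpace Y]
  [TopologicalSpace.PseudoMetrizableSpace Y] [Nonempty Y]

/-- Sets that are not null for measures of maximal entropy are connected by the dynamics with
positive probability with respect to `μ`. -/
lemma exists_measure_inter_preimage_pos (W : WindowCoding T ξ) {μ : Measure Y}
    [IsProbabilityMeasure μ] (hT : MeasurePreserving T μ μ) (hξ : MeasurableLevels ξ)
    {Cp G Cs : Set (List A)} {C : ℝ} (hC1 : 1 ≤ C)
    (hC : ∀ n : ℕ, (count T ξ n univ : ℝ) ≤ C * Real.exp (n * langEntropy T ξ))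
    (hgood : ∀ ε > 0, ∃ M, ∀ n : ℕ, ((layer (lang T ξ \ goodWords (lang T ξ) Cp G Cs M) n).ncard
      : ℝ) ≤ ε * Real.exp (n * langEntropy T ξ))
    (hμ : HasTwoWordBound T ξ (goodWords (lang T ξ) Cp G Cs) (langEntropy T ξ) μ)
    {ν₁ ν₂ : Measure Y} [IsProbabilityMeasure ν₁] [IsProbabilityMeasure ν₂]
    (hν₁ : MeasurePreserving T ν₁ ν₁) (hν₂ : MeasurePreserving T ν₂ ν₂)
    (he₁ : langEntropy T ξ ≤ entropyRate T ν₁ ξ) (he₂ : langEntropy T ξ ≤ entropyRate T ν₂ ξ)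
    {A₁ A₂ : Set Y} (hA₁ : MeasurableSet A₁) (hA₂ : MeasurableSet A₂) (hp₁ : ν₁ A₁ ≠ 0)
    (hp₂ : ν₂ A₂ ≠ 0) : ∃ n, μ (A₁ ∩ T^[n] ⁻¹' A₂) ≠ 0 := by
  obtain ⟨K₁, hK₁, hc₁, hk₁⟩ := hA₁.exists_lt_isClosed_of_ne_top (measure_ne_top ν₁ _)
    (pos_iff_ne_zero.2 hp₁)
  obtain ⟨K₂, hK₂, hc₂, hk₂⟩ := hA₂.exists_lt_isClosed_of_ne_top (measure_ne_top ν₂ _)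
    (pos_iff_ne_zero.2 hp₂)
  by_contra! hcon
  have hr₁ : 0 < ν₁.real K₁ := ENNReal.toReal_pos hk₁.ne' (measure_ne_top _ _)
  have hr₂ : 0 < ν₂.real K₂ := ENNReal.toReal_pos hk₂.ne' (measure_ne_top _ _)
  set d := min (ν₁.real K₁) (ν₂.real K₂)
  obtain ⟨M, c, hc, hM⟩ := exists_le_ncard_goodWords hC1 hC hgood hξ (lt_min hr₁ hr₂ : 0 < d)
  obtain ⟨c', hc', J, hJ⟩ := hμ M
  set h := langEntropy T ξ
  -- If A₁ never meets a preimage of A₂ in positive measure, the connections given by the two-word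
  -- bound must use points of the hulls outside K₁ or K₂. Their measure tends to zero as m grows,
  -- whereas the left side is a fixed positive number.
  have key : ∀ m, c ^ 2 * c' ≤ (J + 1) * ((μ.real (W.hull m K₁) - μ.real K₁) +
      (μ.real (W.hull m K₂) - μ.real K₂)) := by
    intro m
    set n := W.size m
    set S : Set Y → Set (List A) := fun K => List.ofFn '' (W.window m '' K)
    have hS : ∀ K, word T ξ n ⁻¹' S K = T^[W.offset m] ⁻¹' W.hull m K := fun K => by
      ext y
      simp only [S, mem_preimage, WindowCoding.hull, W.window_iterate, word]
      exact List.ofFn_injective.mem_set_image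
    have hU : ∀ (ν : Measure Y), IsProbabilityMeasure ν → MeasurePreserving T ν ν → ∀ K,
        ν.real K ≤ ν.real (word T ξ n ⁻¹' S K) := fun ν _ hν K => by
      rw [hS, (hν.iterate _).measureReal_preimage
        (W.measurableSet_hull m K).nullMeasurableSet]
      exact measureReal_mono (W.subset_hull m K)
    have e₁ := hM ν₁ hν₁ he₁ n (S K₁) ((min_le_left _ _).trans (hU ν₁ inferInstance hν₁ K₁))
    have e₂ := hM ν₂ hν₂ he₂ n (S K₂) ((min_le_right _ _).trans (hU ν₂ inferInstance hν₂ K₂))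
    have e₃ := le_sum_measureReal_of_two_words (S₁ := S K₁) (S₂ := S K₂) (n := n) hT.measurable hξ hJ
    have e₄ : ∀ j, μ.real (word T ξ n ⁻¹' S K₁ ∩ T^[n + j] ⁻¹' (word T ξ n ⁻¹' S K₂)) ≤
        (μ.real (W.hull m K₁) - μ.real K₁) + (μ.real (W.hull m K₂) - μ.real K₂) := by
      intro j
      have hm₁ := W.measurableSet_hull m K₁
      have hm₂ := W.measurableSet_hull m K₂
      have f₁ : word T ξ n ⁻¹' S K₁ ∩ T^[n + j] ⁻¹' (word T ξ n ⁻¹' S K₂) =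
          T^[W.offset m] ⁻¹' (W.hull m K₁ ∩ T^[n + j] ⁻¹' W.hull m K₂) := by
        rw [hS, hS, preimage_inter, ← preimage_comp, ← preimage_comp,
          (Function.Commute.iterate_iterate_self T (n + j) (W.offset m)).comp_eq]
      rw [f₁, (hT.iterate _).measureReal_preimage
        (hm₁.inter ((hT.measurable.iterate _) hm₂)).nullMeasurableSet]
      have f₂ : W.hull m K₁ ∩ T^[n + j] ⁻¹' W.hull m K₂ ⊆
          (W.hull m K₁ \ K₁) ∪ T^[n + j] ⁻¹' (W.hull m K₂ \ K₂) ∪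
            (A₁ ∩ T^[n + j] ⁻¹' A₂) := by
        rintro y ⟨hy₁, hy₂⟩
        by_cases g₁ : y ∈ K₁
        · by_cases g₂ : T^[n + j] y ∈ K₂
          · exact Or.inr ⟨hK₁ g₁, hK₂ g₂⟩
          · exact Or.inl (Or.inr ⟨hy₂, g₂⟩)
        · exact Or.inl (Or.inl ⟨hy₁, g₁⟩)
      refine (measureReal_mono f₂).trans ((measureReal_union_le _ _).trans ?_)
      rw [measureReal_def μ (A₁ ∩ _), hcon, ENNReal.toReal_zero, add_zero]
      refine (measureReal_union_le _ _).trans (le_of_eq ?_)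
      rw [(hT.iterate _).measureReal_preimage (hm₂.diff hc₂.measurableSet).nullMeasurableSet,
        measureReal_sdiff (W.subset_hull m _) hc₁.measurableSet,
        measureReal_sdiff (W.subset_hull m _) hc₂.measurableSet]
    have e₅ := e₃.trans (Finset.sum_le_sum fun j _ => e₄ j)
    rw [Finset.sum_const, Finset.card_range, nsmul_eq_mul] at e₅
    push_cast at e₅
    refine le_trans ?_ e₅
    -- There are at least (c e^{nh})² pairs of good words, each of probability at least c' e^{-2nh}:
    -- the exponentials cancel.
    calc c ^ 2 * c' = (c * Real.exp (n * h)) * (c * Real.exp (n * h)) *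
          (c' * Real.exp (-((n + n) * h))) := by
          have : Real.exp (n * h) * Real.exp (n * h) * Real.exp (-((n + n) * h)) = 1 := by
            rw [← Real.exp_add, ← Real.exp_add, ← Real.exp_zero]; congr 1; ring
          linear_combination (-(c ^ 2 * c')) * this
      _ ≤ _ := by gcongr
  have hlim : Tendsto (fun m => ((J : ℝ) + 1) * ((μ.real (W.hull m K₁) - μ.real K₁) +
      (μ.real (W.hull m K₂) - μ.real K₂))) atTop (𝓝 (((J : ℝ) + 1) * (0 + 0))) := by
    have t₁ := (W.tendsto_measureReal_hull μ hc₁).sub_const (μ.real K₁)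
    have t₂ := (W.tendsto_measureReal_hull μ hc₂).sub_const (μ.real K₂)
    rw [sub_self] at t₁ t₂
    exact (t₁.add t₂).const_mul _
  have := ge_of_tendsto' hlim key
  have : 0 < c ^ 2 * c' := by positivity
  linarith

/-- A measure of maximal entropy with the two-word bound is the only one. -/
lemma eq_of_hasTwoWordBound (W : WindowCoding T ξ) {μ : Measure Y}
    [IsProbabilityMeasure μ] (hT : MeasurePreserving T μ μ) (hξ : MeasurableLevels ξ)
    {Cp G Cs : Set (List A)} {C : ℝ} (hC1 : 1 ≤ C)
    (hC : ∀ n : ℕ, (count T ξ n univ : ℝ) ≤ C * Real.exp (n * langEntropy T ξ))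
    (hgood : ∀ ε > 0, ∃ M, ∀ n : ℕ, ((layer (lang T ξ \ goodWords (lang T ξ) Cp G Cs M) n).ncard
      : ℝ) ≤ ε * Real.exp (n * langEntropy T ξ))
    (hμ : HasTwoWordBound T ξ (goodWords (lang T ξ) Cp G Cs) (langEntropy T ξ) μ)
    (he : langEntropy T ξ ≤ entropyRate T μ ξ)
    {ν : Measure Y} [IsProbabilityMeasure ν] (hν : MeasurePreserving T ν ν)
    (heν : langEntropy T ξ ≤ entropyRate T ν ξ) : ν = μ := by
  have hac : ν ≪ μ := by
    refine Measure.AbsolutelyContinuous.mk fun s hs hs0 => ?_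
    by_contra hns
    obtain ⟨n, hn⟩ := exists_measure_inter_preimage_pos W hT hξ hC1 hC hgood hμ hν hν heν heν hs
      MeasurableSet.univ hns (by simp)
    exact hn (measure_mono_null inter_subset_left hs0)
  -- An invariant set and its complement cannot be connected by the dynamics, so one of them is
  -- null.
  have herg : Ergodic T μ := by
    refine ⟨hT, ⟨fun s hs hinv => ?_⟩⟩
    rw [eventuallyConst_set', ae_eq_empty, ae_eq_univ]
    by_contra! hne
    obtain ⟨n, hn⟩ := exists_measure_inter_preimage_pos W hT hξ hC1 hC hgood hμ hT hT he he hs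
      hs.compl hne.1 hne.2
    refine hn ?_
    have : T^[n] ⁻¹' sᶜ = sᶜ := by
      rw [preimage_compl]; congr 1
      clear hn
      induction n with
      | zero => rfl
      | succ n ih => rw [Function.iterate_succ', preimage_comp, hinv]; exact ih
    rw [this, inter_compl_self, measure_empty]
  exact herg.eq_of_absolutelyContinuous hν hac

end KeyLemma

/-! ### Normalised counting measures -/

section Empirical

variable {Y ι : Type*} [MeasurableSpace Y]

/-- The normalised counting measure on the points `f i`, `i ∈ s`, with multiplicity. -/
def empirical (s : Finset ι) (f : ι → Y) : Measure Y :=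
  (s.card : ENNReal)⁻¹ • ∑ i ∈ s, Measure.dirac (f i)

open Classical in
lemma empirical_apply (s : Finset ι) (f : ι → Y) {B : Set Y} (hB : MeasurableSet B) :
    empirical s f B = (s.card : ENNReal)⁻¹ * (s.filter fun i => f i ∈ B).card := by
  simp only [empirical, Measure.smul_apply, Measure.finsetSum_apply, smul_eq_mul]
  congr 1
  rw [Finset.card_filter]
  push_cast
  refine Finset.sum_congr rfl fun i _ => ?_
  rw [Measure.dirac_apply' _ hB, indicator_apply]
  rfl

lemma isProbabilityMeasure_empirical {s : Finset ι} (hs : s.Nonempty) (f : ι → Y) :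
    IsProbabilityMeasure (empirical s f) := by
  constructor
  rw [empirical_apply s f MeasurableSet.univ]
  simp only [mem_univ, Finset.filter_true]
  exact ENNReal.inv_mul_cancel (by simpa using hs.ne_empty) (by simp)

open Classical in
lemma empirical_real (s : Finset ι) (f : ι → Y) {B : Set Y} (hB : MeasurableSet B) :
    (empirical s f).real B = (s.filter fun i => f i ∈ B).card / s.card := by
  rw [measureReal_def, empirical_apply s f hB, ENNReal.toReal_mul, ENNReal.toReal_inv]
  simp [div_eq_inv_mul]

end Empirical

/-! ### Orbit averages over all words -/

section Construction

variable {Y A : Type*} {T : Y → Y} {ξ : Y → A}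

lemma word_iterate_eq {n k N : ℕ} (h : k + n ≤ N) {y z : Y} (hyz : word T ξ N y = word T ξ N z) :
    word T ξ n (T^[k] y) = word T ξ n (T^[k] z) := by
  obtain ⟨r, rfl⟩ := Nat.exists_eq_add_of_le h
  rw [word_add T ξ (k + n) r, word_add T ξ (k + n) r] at hyz
  have h1 := (List.append_inj hyz (by simp)).1
  rw [word_add T ξ k n, word_add T ξ k n] at h1
  exact (List.append_inj h1 (by simp)).2

lemma mem_cyl_of_word_eq {n : ℕ} {w : List A} (hw : w.length ≤ n) {y z : Y}
    (h : word T ξ n y = word T ξ n z) (hy : y ∈ cyl T ξ w) : z ∈ cyl T ξ w :=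
  (word_iterate_eq (k := 0) (by omega) h).symm.trans hy

variable [Finite A] (T ξ)

/-- The words of length `N` as a finset. -/
def wordFinset (N : ℕ) : Finset (List A) := (finite_word_image T ξ N univ).toFinset

lemma card_wordFinset (N : ℕ) : (wordFinset T ξ N).card = count T ξ N univ :=
  (ncard_eq_toFinset_card _ _).symm

variable [Nonempty Y]

/-- A point that shows the given word of length `N`. -/
def wordPoint (N : ℕ) (w : List A) : Y := Function.invFun (word T ξ N) w

lemma word_wordPoint {N : ℕ} {w : List A} (hw : w ∈ wordFinset T ξ N) :
    word T ξ N (wordPoint T ξ N w) = w := by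
  obtain ⟨y, -, hy⟩ := (Finite.mem_toFinset _).1 hw
  exact Function.invFun_eq ⟨y, hy⟩

open Classical in
/-- The number of chosen points that visit `B` at time `k`. -/
def visits (N : ℕ) (B : Set Y) (k : ℕ) : ℕ :=
  ((wordFinset T ξ N).filter fun w => T^[k] (wordPoint T ξ N w) ∈ B).card

open Classical in
lemma visits_le (N : ℕ) (B : Set Y) (k : ℕ) : visits T ξ N B k ≤ count T ξ N univ := by
  rw [← card_wordFinset]; exact Finset.card_filter_le _ _

/-- A visit to a set determined by n letters does not depend on the chosen representative, as long
as these letters lie within the first N. -/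
lemma visits_eq_count {n k N : ℕ} (h : k + n ≤ N) {B : Set Y}
    (hB : ∀ y z, word T ξ n y = word T ξ n z → y ∈ B → z ∈ B) :
    visits T ξ N B k = count T ξ N (T^[k] ⁻¹' B) := by
  classical
  rw [visits, count, ← ncard_coe_finset]
  congr 1
  ext w
  simp only [Finset.coe_filter, mem_ofPred_eq, mem_image, mem_preimage]
  constructor
  · rintro ⟨hw, hB⟩; exact ⟨_, hB, word_wordPoint T ξ hw⟩
  · rintro ⟨y, hy, rfl⟩
    have hw : word T ξ N y ∈ wordFinset T ξ N := (Finite.mem_toFinset _).2 ⟨y, trivial, rfl⟩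
    exact ⟨hw, hB _ _ (word_iterate_eq h (word_wordPoint T ξ hw).symm) hy⟩

variable [MeasurableSpace Y]

/-- The average over the first `N` iterates of the uniform distribution on words of length `N`. -/
def orbitAverage (N : ℕ) : Measure Y :=
  empirical (Finset.range N ×ˢ wordFinset T ξ N) fun q => T^[q.1] (wordPoint T ξ N q.2)

lemma isProbabilityMeasure_orbitAverage {N : ℕ} (hN : 0 < N) :
    IsProbabilityMeasure (orbitAverage T ξ N) := by
  refine isProbabilityMeasure_empirical ?_ _
  rw [← Finset.card_pos, Finset.card_product, Finset.card_range, card_wordFinset]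
  exact Nat.mul_pos hN (count_pos T ξ N)

lemma orbitAverage_real (N : ℕ) {B : Set Y} (hB : MeasurableSet B) :
    (orbitAverage T ξ N).real B =
      (∑ k ∈ Finset.range N, (visits T ξ N B k : ℝ)) / (N * count T ξ N univ) := by
  classical
  rw [orbitAverage, empirical_real _ _ hB, Finset.card_product, Finset.card_range,
    card_wordFinset]
  push_cast
  congr 1
  rw [Finset.card_filter, Finset.sum_product]
  push_cast
  refine Finset.sum_congr rfl fun k _ => ?_
  rw [visits, Finset.card_filter]
  push_cast
  rfl

/-- The sum over times telescopes: only the visits at times 0 and N remain. -/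
lemma abs_orbitAverage_preimage_sub_le {N : ℕ} (hN : 0 < N) (hT : Measurable T) {B : Set Y}
    (hB : MeasurableSet B) :
    |(orbitAverage T ξ N).real (T ⁻¹' B) - (orbitAverage T ξ N).real B| ≤ 1 / N := by
  have hv : ∀ k, visits T ξ N (T ⁻¹' B) k = visits T ξ N B (k + 1) := fun k => by
    classical
    simp only [visits, mem_preimage, ← Function.iterate_succ_apply' T]
  rw [orbitAverage_real T ξ N (hT hB), orbitAverage_real T ξ N hB, ← sub_div,
    ← Finset.sum_sub_distrib]
  simp only [hv]
  rw [Finset.sum_range_sub (fun k => (visits T ξ N B k : ℝ)), abs_div]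
  have hL : (0 : ℝ) < count T ξ N univ := by exact_mod_cast count_pos T ξ N
  have hN' : (0 : ℝ) < N := by exact_mod_cast hN
  rw [abs_of_pos (by positivity : (0 : ℝ) < N * count T ξ N univ),
    div_le_div_iff₀ (by positivity) hN']
  have h1 : (visits T ξ N B N : ℝ) ≤ count T ξ N univ := by exact_mod_cast visits_le T ξ N B N
  have h2 : (visits T ξ N B 0 : ℝ) ≤ count T ξ N univ := by exact_mod_cast visits_le T ξ N B 0
  have h3 : |(visits T ξ N B N : ℝ) - visits T ξ N B 0| ≤ count T ξ N univ := by
    rw [abs_le]; constructor <;> linarith [Nat.cast_nonneg (α := ℝ) (visits T ξ N B 0),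
      Nat.cast_nonneg (α := ℝ) (visits T ξ N B N)]
  nlinarith

variable {T ξ}

/-- Fixing w at time k leaves k letters before it and N - k - |w| after it, hence at most C²
e^{(N-|w|)h} words, against at least e^{Nh} in total. The second term covers the last |w| times,
where w may not fit. -/
lemma orbitAverage_cyl_le {C : ℝ} (hC0 : 0 < C)
    (hC : ∀ n : ℕ, (count T ξ n univ : ℝ) ≤ C * Real.exp (n * langEntropy T ξ))
    {w : List A} (hm : MeasurableSet (cyl T ξ w)) {N : ℕ} (hN : 0 < N) :
    (orbitAverage T ξ N).real (cyl T ξ w) ≤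
      C ^ 2 * Real.exp (-(w.length * langEntropy T ξ)) + w.length / N := by
  set h := langEntropy T ξ
  set n := w.length
  have hL : (0 : ℝ) < count T ξ N univ := by exact_mod_cast count_pos T ξ N
  have hN' : (0 : ℝ) < N := by exact_mod_cast hN
  have hv : ∀ k, k + n ≤ N → (visits T ξ N (cyl T ξ w) k : ℝ) ≤
      C ^ 2 * Real.exp (-(n * h)) * count T ξ N univ := by
    intro k hk
    rw [visits_eq_count T ξ hk fun y z h hy => mem_cyl_of_word_eq le_rfl h hy]
    obtain ⟨r, rfl⟩ := Nat.exists_eq_add_of_le hk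
    have h1 : count T ξ (k + n + r) (T^[k] ⁻¹' cyl T ξ w) ≤
        count T ξ k univ * (count T ξ n (cyl T ξ w) * count T ξ r univ) := by
      refine le_trans ?_ ((count_add_le T ξ k (n + r) univ _).trans
        (Nat.mul_le_mul_left _ (count_add_le T ξ n r _ univ)))
      rw [add_assoc]
      have hsub : T^[k] ⁻¹' cyl T ξ w ⊆ univ ∩ T^[k] ⁻¹' (cyl T ξ w ∩ T^[n] ⁻¹' univ) :=
        fun y hy => ⟨trivial, hy, trivial⟩
      exact count_mono T ξ hsub _
    have h2 : count T ξ n (cyl T ξ w) ≤ 1 := by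
      have : word T ξ n '' cyl T ξ w ⊆ {w} := by rintro _ ⟨y, hy, rfl⟩; exact hy
      exact (ncard_le_ncard this).trans (ncard_singleton w).le
    have h3 : (count T ξ (k + n + r) (T^[k] ⁻¹' cyl T ξ w) : ℝ) ≤
        count T ξ k univ * (1 * count T ξ r univ) := by
      refine le_trans (by exact_mod_cast h1) (?_ : (count T ξ k univ : ℝ) *
        (count T ξ n (cyl T ξ w) * count T ξ r univ) ≤ _)
      gcongr
      exact_mod_cast h2
    have h4 := exp_le_count T ξ (k + n + r)
    have e : Real.exp ((k + n + r : ℕ) * h) = Real.exp (k * h) * Real.exp (r * h) *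
        Real.exp (n * h) := by
      rw [← Real.exp_add, ← Real.exp_add]; push_cast; congr 1; ring
    calc _ ≤ _ := h3
      _ ≤ (C * Real.exp (k * h)) * (1 * (C * Real.exp (r * h))) := by
          gcongr
          · exact hC k
          · exact hC r
      _ = C ^ 2 * Real.exp (-(n * h)) * Real.exp ((k + n + r : ℕ) * h) := by
          rw [e, Real.exp_neg]; field_simp
      _ ≤ _ := by gcongr
  rw [orbitAverage_real T ξ N hm, div_le_iff₀ (by positivity)]
  have hsum : ∀ k ∈ Finset.range N, (visits T ξ N (cyl T ξ w) k : ℝ) ≤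
      C ^ 2 * Real.exp (-(n * h)) * count T ξ N univ +
        if N - n ≤ k then (count T ξ N univ : ℝ) else 0 := by
    intro k _
    split_ifs with hk
    · have : (visits T ξ N (cyl T ξ w) k : ℝ) ≤ count T ξ N univ := by
        exact_mod_cast visits_le T ξ N _ k
      have : 0 ≤ C ^ 2 * Real.exp (-(n * h)) * count T ξ N univ := by positivity
      linarith
    · rw [add_zero]; exact hv k (by omega)
  refine (Finset.sum_le_sum hsum).trans ?_
  rw [Finset.sum_add_distrib, Finset.sum_const, Finset.card_range, nsmul_eq_mul,
    ← Finset.sum_filter, Finset.sum_const, nsmul_eq_mul]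
  have hcard : ((Finset.range N).filter fun k => N - n ≤ k).card ≤ n := by
    have : (Finset.range N).filter (fun k => N - n ≤ k) ⊆ Finset.Ico (N - n) N := by
      intro k hk
      simp only [Finset.mem_filter, Finset.mem_range] at hk
      simp only [Finset.mem_Ico]; omega
    exact (Finset.card_le_card this).trans (by rw [Nat.card_Ico]; omega)
  have hcard' : ((((Finset.range N).filter fun k => N - n ≤ k).card : ℕ) : ℝ) ≤ n := by
    exact_mod_cast hcard
  calc _ ≤ (N : ℝ) * (C ^ 2 * Real.exp (-(n * h)) * count T ξ N univ) + n * count T ξ N univ := by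
        gcongr
    _ = _ := by field_simp

/-- The lower bound holds at all but t + R + n of the N times, a proportion that vanishes in the
limit; division by C normalises by the number of all words. -/
lemma le_orbitAverage_of_le_count {B : Set Y} (hB : MeasurableSet B)
    {n t R : ℕ} {C d : ℝ} {h : ℝ} (hBn : ∀ y z, word T ξ n y = word T ξ n z → y ∈ B → z ∈ B)
    (hC0 : 0 < C) (hC : ∀ n : ℕ, (count T ξ n univ : ℝ) ≤ C * Real.exp (n * h)) (hd : 0 ≤ d)
    (hlow : ∀ N k, t ≤ k → k + R ≤ N → d * Real.exp (N * h) ≤ count T ξ N (T^[k] ⁻¹' B))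
    {N : ℕ} (hN : 0 < N) :
    d / C * (1 - (t + (R + n)) / N) ≤ (orbitAverage T ξ N).real B := by
  have hL : (0 : ℝ) < count T ξ N univ := by exact_mod_cast count_pos T ξ N
  have hN' : (0 : ℝ) < N := by exact_mod_cast hN
  rw [orbitAverage_real T ξ N hB, le_div_iff₀ (by positivity)]
  have h1 : ∀ k ∈ Finset.Ico t (N - (R + n)), d / C * count T ξ N univ ≤ visits T ξ N B k := by
    intro k hk
    rw [Finset.mem_Ico] at hk
    rw [visits_eq_count T ξ (by omega : k + n ≤ N) hBn, div_mul_eq_mul_div, div_le_iff₀ hC0]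
    have e1 := hlow N k hk.1 (by omega)
    calc d * count T ξ N univ ≤ d * (C * Real.exp (N * h)) := by gcongr; exact hC N
      _ = d * Real.exp (N * h) * C := by ring
      _ ≤ _ := by gcongr
  have h2 : ∑ k ∈ Finset.Ico t (N - (R + n)), (visits T ξ N B k : ℝ) ≤
      ∑ k ∈ Finset.range N, (visits T ξ N B k : ℝ) := by
    refine Finset.sum_le_sum_of_subset_of_nonneg (fun k hk => ?_) fun _ _ _ => Nat.cast_nonneg _
    simp only [Finset.mem_Ico, Finset.mem_range] at hk ⊢; omega
  refine le_trans ?_ ((Finset.sum_le_sum h1).trans h2)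
  rw [Finset.sum_const, Nat.card_Ico, nsmul_eq_mul]
  have h3 : (N : ℝ) - (t + (R + n)) ≤ ((N - (R + n) - t : ℕ) : ℝ) := by
    have : N ≤ (N - (R + n) - t) + (t + (R + n)) := by omega
    have : (N : ℝ) ≤ ((N - (R + n) - t : ℕ) : ℝ) + (t + (R + n)) := by exact_mod_cast this
    linarith
  calc d / C * (1 - (t + (R + n)) / N) * (N * count T ξ N univ)
      = (N - (t + (R + n))) * (d / C * count T ξ N univ) := by field_simp
    _ ≤ _ := by gcongr

end Construction

/-! ### Weak limits and the Gibbs measure -/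

section Limits

lemma isClopen_preimage_word {Y A : Type*} [TopologicalSpace Y] {T : Y → Y} {ξ : Y → A} (hT : Continuous T)
    (hξ : IsLocallyConstant ξ) (n : ℕ) (S : Set (List A)) : IsClopen (word T ξ n ⁻¹' S) := by
  have h : IsLocallyConstant (word T ξ n) := by
    rw [IsLocallyConstant.iff_eventually_eq]
    intro x
    have h1 : ∀ᶠ y in 𝓝 x, ∀ i : Fin n, ξ (T^[i] y) = ξ (T^[i] x) :=
      eventually_all.2 fun i => (hξ.comp_continuous (hT.iterate i)).eventually_eq x
    filter_upwards [h1] with y hy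
    exact congrArg List.ofFn (funext hy)
  refine ⟨?_, h S⟩
  rw [← isOpen_compl_iff, ← preimage_compl]; exact h _

lemma isClopen_cyl {Y A : Type*} [TopologicalSpace Y] {T : Y → Y} {ξ : Y → A} (hT : Continuous T)
    (hξ : IsLocallyConstant ξ) (w : List A) : IsClopen (cyl T ξ w) :=
  isClopen_preimage_word hT hξ w.length {w}

variable {Y : Type*} [TopologicalSpace Y] [MeasurableSpace Y] [OpensMeasurableSpace Y]
  [HasOuterApproxClosed Y]

lemma tendsto_measureReal_of_isClopen {ι : Type*} {F : Filter ι} {μs : ι → ProbabilityMeasure Y}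
    {μ : ProbabilityMeasure Y} (h : Tendsto μs F (𝓝 μ)) {B : Set Y} (hB : IsClopen B) :
    Tendsto (fun i => (μs i : Measure Y).real B) F (𝓝 ((μ : Measure Y).real B)) :=
  (NNReal.continuous_coe.tendsto _).comp
    (ProbabilityMeasure.tendsto_measure_of_isClopen_of_tendsto h hB)

/-- Weak limits of asymptotically invariant measures are invariant. -/
lemma measurePreserving_of_tendsto [CompactSpace Y] [BorelSpace Y] {A ι : Type*} {T : Y → Y}
    {ξ : Y → A} (W : WindowCoding T ξ) (hT : Continuous T) {F : Filter ι} [F.NeBot]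
    {μs : ι → ProbabilityMeasure Y} {μ : ProbabilityMeasure Y} (h : Tendsto μs F (𝓝 μ))
    (hinv : ∀ B, MeasurableSet B → Tendsto (fun i => (μs i : Measure Y).real (T ⁻¹' B) -
      (μs i : Measure Y).real B) F (𝓝 0)) :
    MeasurePreserving T (μ : Measure Y) (μ : Measure Y) := by
  refine ⟨hT.measurable, ?_⟩
  have := Measure.isProbabilityMeasure_map (μ := (μ : Measure Y)) hT.measurable.aemeasurable
  refine W.measure_ext fun m S => ?_
  have hB : IsClopen (W.window m ⁻¹' S) := ⟨W.isClosed_preimage m S, W.isOpen_preimage m S⟩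
  rw [map_measureReal_apply hT.measurable hB.isOpen.measurableSet]
  have h1 := tendsto_measureReal_of_isClopen h (hB.preimage hT)
  have h2 := tendsto_measureReal_of_isClopen h hB
  exact sub_eq_zero.1 (tendsto_nhds_unique (h1.sub h2) (hinv _ hB.isOpen.measurableSet))

/-- An invariant measure with the upper Gibbs bound and the two-word lower bound. -/
lemma exists_gibbs [CompactSpace Y] [T2Space Y] [BorelSpace Y] [Nonempty Y] {A : Type*} [Finite A]
    {T : Y → Y} {ξ : Y → A} (W : WindowCoding T ξ) (hT : Continuous T)
    (hξ : IsLocallyConstant ξ) {Cp G Cs : Set (List A)} {t : ℕ} {C c : ℝ} {τ₀ : ℕ}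
    (hS : HasSSpecification (lang T ξ) G t)
    (hext : HasBoundedExtension (lang T ξ) Cp G Cs)
    (hC : ∀ n : ℕ, (count T ξ n univ : ℝ) ≤ C * Real.exp (n * langEntropy T ξ)) (hC0 : 0 < C)
    (hc : ∀ n : ℕ, ∃ j ≤ τ₀, c * Real.exp (n * langEntropy T ξ) ≤ (layer G (n + j)).ncard)
    (hc0 : 0 < c) :
    ∃ μ : ProbabilityMeasure Y, MeasurePreserving T (μ : Measure Y) (μ : Measure Y) ∧
      (∀ w, (μ : Measure Y).real (cyl T ξ w) ≤
        C ^ 2 * Real.exp (-(w.length * langEntropy T ξ))) ∧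
      HasTwoWordBound T ξ (goodWords (lang T ξ) Cp G Cs) (langEntropy T ξ) μ := by
  set h := langEntropy T ξ
  set μs : ℕ → ProbabilityMeasure Y := fun N =>
    ⟨orbitAverage T ξ (N + 1), isProbabilityMeasure_orbitAverage T ξ N.succ_pos⟩ with hμs
  -- The space of probability measures is compact, so an ultrafilter finer than `atTop` provides a
  -- limit without extracting a subsequence.
  set F : Ultrafilter ℕ := Ultrafilter.of atTop
  have hF : (F : Filter ℕ) ≤ atTop := Ultrafilter.of_le atTop
  obtain ⟨μ, -, hμ⟩ := isCompact_univ.ultrafilter_le_nhds (F.map μs) (by simp)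
  have hlim : Tendsto μs F (𝓝 μ) := hμ
  have hdiv : ∀ a : ℝ, Tendsto (fun N : ℕ => a / ((N + 1 : ℕ) : ℝ)) F (𝓝 0) := fun a =>
    ((tendsto_const_div_atTop_nhds_zero_nat a).comp (tendsto_add_atTop_nat 1)).mono_left hF
  refine ⟨μ, measurePreserving_of_tendsto W hT hlim fun B hB => ?_, fun w => ?_, fun M => ?_⟩
  · rw [tendsto_zero_iff_abs_tendsto_zero]
    exact squeeze_zero (fun _ => abs_nonneg _)
      (fun N => abs_orbitAverage_preimage_sub_le T ξ N.succ_pos hT.measurable hB) (hdiv 1)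
  · have hB := isClopen_cyl hT hξ w
    have h1 := (tendsto_const_nhds (x := C ^ 2 * Real.exp (-(w.length * h)))).add (hdiv w.length)
    rw [add_zero] at h1
    exact le_of_tendsto_of_tendsto' (tendsto_measureReal_of_isClopen hlim hB) h1
      fun N => orbitAverage_cyl_le hC0 hC hB.isOpen.measurableSet N.succ_pos
  · obtain ⟨d, hd, J, R, hJ⟩ := exists_le_count_two_words hS hext (langEntropy_nonneg T ξ) hC hC0
      hc hc0 M
    refine ⟨d / C, by positivity, J, fun w₁ hw₁ w₂ hw₂ => ?_⟩
    obtain ⟨j, hj, hlow⟩ := hJ w₁ hw₁ w₂ hw₂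
    refine ⟨j, hj, ?_⟩
    set B := cyl T ξ w₁ ∩ T^[w₁.length + j] ⁻¹' cyl T ξ w₂
    have hB : IsClopen B := (isClopen_cyl hT hξ w₁).inter
      ((isClopen_cyl hT hξ w₂).preimage (hT.iterate _))
    set n := w₁.length + j + w₂.length
    have hBn : ∀ y z, word T ξ n y = word T ξ n z → y ∈ B → z ∈ B := by
      rintro y z hyz ⟨hy₁, hy₂⟩
      refine ⟨mem_cyl_of_word_eq (by omega) hyz hy₁, ?_⟩
      exact mem_cyl_of_word_eq le_rfl (word_iterate_eq le_rfl hyz) hy₂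
    set e := d * Real.exp (-((w₁.length + w₂.length) * h)) with he
    have hlow' : ∀ N k, t ≤ k → k + (w₁.length + w₂.length + R) ≤ N →
        e * Real.exp (N * h) ≤ count T ξ N (T^[k] ⁻¹' B) := by
      intro N k hk hN
      refine le_trans (le_of_eq ?_) (hlow k hk N (by omega))
      rw [he, mul_assoc, ← Real.exp_add]
      congr 2; ring
    have h1 : Tendsto (fun N : ℕ => e / C * (1 - (t + ((w₁.length + w₂.length + R : ℕ) + n)) /
        ((N + 1 : ℕ) : ℝ))) F (𝓝 (e / C * (1 - 0))) :=
      ((hdiv _).const_sub 1).const_mul _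
    have h2 := le_of_tendsto_of_tendsto' h1 (tendsto_measureReal_of_isClopen hlim hB)
      fun N => le_orbitAverage_of_le_count hB.isOpen.measurableSet hBn hC0 hC (by positivity) hlow'
        N.succ_pos
    rw [sub_zero, mul_one] at h2
    refine le_trans (le_of_eq ?_) h2
    rw [he]; ring

end Limits

/-! ### Intrinsic ergodicity of coded systems -/

/-- A real r strictly between the growth rate and h gives comparison with the geometric series of
ratio e^{r-h}. -/
lemma summable_of_growthRate_lt {A : Type*} [Finite A] {D : Set (List A)} {h : ℝ}
    (hD : growthRate D < h) :
    Summable fun n : ℕ => ((layer D n).ncard : ℝ) * Real.exp (-(n * h)) := by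
  obtain ⟨r, hr1, hr2⟩ := EReal.lt_iff_exists_real_btwn.1 hD
  have hrh : r < h := by exact_mod_cast hr2
  have h1 := ExpGrowth.eventually_le_exp hr1
  have hgeo : Summable fun n : ℕ => Real.exp (n * (r - h)) := by
    have := summable_geometric_of_lt_one (Real.exp_pos (r - h)).le
      (Real.exp_lt_one_iff.2 (by linarith : r - h < 0))
    refine this.congr fun n => ?_
    rw [← Real.exp_nat_mul]
  refine hgeo.of_norm_bounded_eventually_nat ?_
  filter_upwards [h1] with n hn
  have e1 : (r : EReal) * (n : EReal) = ((r * n : ℝ) : EReal) := by push_cast; rfl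
  have hfin : (layer D n).Finite := finite_layer D n
  have e2 : ({w ∈ D | w.length = n}.encard : ℕ∞) = ((layer D n).ncard : ℕ∞) :=
    hfin.cast_ncard_eq.symm
  rw [e1, EReal.exp_coe, e2] at hn
  have e3 : ((layer D n).ncard : ℝ) ≤ Real.exp (r * n) := by
    rw [ENat.toENNReal_coe] at hn
    have := (ENNReal.toReal_mono ENNReal.ofReal_ne_top hn)
    rwa [ENNReal.toReal_natCast, ENNReal.toReal_ofReal (Real.exp_pos _).le] at this
  rw [Real.norm_of_nonneg (by positivity)]
  calc ((layer D n).ncard : ℝ) * Real.exp (-(n * h)) ≤ Real.exp (r * n) * Real.exp (-(n * h)) := by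
        gcongr
    _ = _ := by rw [← Real.exp_add]; congr 1; ring

section Coded

variable {Y : Type*} [TopologicalSpace Y] [CompactSpace Y] [MeasurableSpace Y] [BorelSpace Y]
  [TopologicalSpace.PseudoMetrizableSpace Y] [Nonempty Y] {p : ℕ} {T : Y → Y} {ξ : Y → Fin p}

lemma measureEntropy_eq_entropyRate (W : WindowCoding T ξ) (hξ : MeasurableLevels ξ)
    {μ : Measure Y} [IsProbabilityMeasure μ] (hμ : MeasurePreserving T μ μ) :
    measureEntropy T μ = entropyRate T μ ξ := by
  refine le_antisymm (iSup_le fun k => iSup₂_le fun ζ hζ => ?_) ?_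
  · exact W.entropyRate_le hμ hξ fun a => hζ (measurableSet_singleton a)
  · have : Measurable ξ := measurable_to_countable' hξ
    exact le_iSup_of_le p (le_iSup₂_of_le ξ this le_rfl)

/-- The measure μ₀ shows that the supremum of the entropies is attained and equals the growth rate
of the language, so maximal entropy becomes an inequality for the single partition `ξ`. -/
lemma isMME_iff (W : WindowCoding T ξ) (hξ : MeasurableLevels ξ) {μ₀ : ProbabilityMeasure Y}
    (hμ₀ : MeasurePreserving T (μ₀ : Measure Y) (μ₀ : Measure Y))
    (he₀ : langEntropy T ξ ≤ entropyRate T (μ₀ : Measure Y) ξ) (ν : ProbabilityMeasure Y) :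
    IsMME T ν ↔ MeasurePreserving T (ν : Measure Y) (ν : Measure Y) ∧
      langEntropy T ξ ≤ entropyRate T (ν : Measure Y) ξ := by
  have hsup : (⨆ (ν : ProbabilityMeasure Y)
      (_ : MeasurePreserving T (ν : Measure Y) (ν : Measure Y)),
        measureEntropy T (ν : Measure Y)) = langEntropy T ξ := by
    refine le_antisymm (iSup₂_le fun ν hν => ?_) ?_
    · rw [measureEntropy_eq_entropyRate W hξ hν]
      exact entropyRate_le_langEntropy hν.measurable hξ
    · refine le_iSup₂_of_le μ₀ hμ₀ ?_
      rwa [measureEntropy_eq_entropyRate W hξ hμ₀]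
  unfold IsMME
  rw [hsup]
  refine and_congr_right fun hν => ?_
  rw [measureEntropy_eq_entropyRate W hξ hν]
  exact ⟨fun h => h.ge, fun h => le_antisymm (entropyRate_le_langEntropy hν.measurable hξ) h⟩

/-- Uniform counting bounds and a unique invariant measure of full entropy. -/
lemma exists_unique_max_entropy [T2Space Y] (W : WindowCoding T ξ) (hT : Continuous T)
    (hξ : IsLocallyConstant ξ) (hξm : MeasurableLevels ξ) {Cp G Cs : Set (List (Fin p))}
    (hdec : IsDecomposition (lang T ξ) Cp G Cs) {t : ℕ}
    (hS : HasSSpecification (lang T ξ) G t)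
    (hgr : growthRate (Cp ∪ Cs) < langEntropy T ξ)
    (hext : HasBoundedExtension (lang T ξ) Cp G Cs) :
    (∃ μ : ProbabilityMeasure Y, MeasurePreserving T (μ : Measure Y) (μ : Measure Y) ∧
      langEntropy T ξ ≤ entropyRate T (μ : Measure Y) ξ ∧
      ∀ ν : ProbabilityMeasure Y, MeasurePreserving T (ν : Measure Y) (ν : Measure Y) →
        langEntropy T ξ ≤ entropyRate T (ν : Measure Y) ξ → ν = μ) ∧
    (∃ C > 0, ∀ n : ℕ, (count T ξ n univ : ℝ) ≤ C * Real.exp (n * langEntropy T ξ)) ∧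
    ∃ c > 0, ∃ τ : ℕ, ∀ n : ℕ, ∃ j ≤ τ,
      c * Real.exp (n * langEntropy T ξ) ≤ (layer G (n + j)).ncard := by
  set h := langEntropy T ξ
  have hsum := summable_of_growthRate_lt hgr
  have hG : ∀ n, ((layer G n).ncard : ℝ) ≤ Real.exp (t * h) * Real.exp (n * h) := fun n => by
    refine (ncard_layer_le_exp hS n).trans (le_of_eq ?_)
    rw [← Real.exp_add]; congr 1; ring
  obtain ⟨C, hC0, hC⟩ := exists_ncard_layer_le hdec hG (Real.exp_pos _).le hsum
  -- With C + 1 the constant is at least 1, so its logarithm is nonnegative in the later entropy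
  -- estimates.
  have hC' : ∀ n : ℕ, (count T ξ n univ : ℝ) ≤ (C + 1) * Real.exp (n * h) := fun n => by
    rw [count_univ]
    exact (hC n).trans (mul_le_mul_of_nonneg_right (by linarith) (Real.exp_pos _).le)
  have hgood : ∀ ε > 0, ∃ M, ∀ n : ℕ,
      ((layer (lang T ξ \ goodWords (lang T ξ) Cp G Cs M) n).ncard : ℝ) ≤ ε * Real.exp (n * h) :=
    fun ε hε => exists_ncard_layer_diff_le hdec hG (Real.exp_pos _).le hsum hε
  -- The language has at least e^{nh} words of length n, so half of that number remains in G(M).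
  obtain ⟨M, hM⟩ := hgood (1 / 2) (by norm_num)
  have hM' : ∀ n : ℕ, 1 / 2 * Real.exp (n * h) ≤
      (layer (goodWords (lang T ξ) Cp G Cs M) n).ncard := fun n => by
    have h1 := exp_le_count T ξ n
    rw [count_univ] at h1
    have h2 : (layer (lang T ξ) n).ncard ≤ (layer (goodWords (lang T ξ) Cp G Cs M) n).ncard +
        (layer (lang T ξ \ goodWords (lang T ξ) Cp G Cs M) n).ncard := by
      refine (ncard_le_ncard ?_ ((finite_layer _ n).union (finite_layer _ n))).trans
        (ncard_union_le _ _)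
      rintro w ⟨hw, hn⟩
      by_cases hg : w ∈ goodWords (lang T ξ) Cp G Cs M
      · exact Or.inl ⟨hg, hn⟩
      · exact Or.inr ⟨⟨hw, hg⟩, hn⟩
    have h2' : ((layer (lang T ξ) n).ncard : ℝ) ≤
        (layer (goodWords (lang T ξ) Cp G Cs M) n).ncard +
        (layer (lang T ξ \ goodWords (lang T ξ) Cp G Cs M) n).ncard := by exact_mod_cast h2
    have := hM n
    linarith
  obtain ⟨c, hc0, τ, hc⟩ := exists_le_ncard_layer hext hM' (by norm_num)
  obtain ⟨μ, hμ, hμC, hμ2⟩ := exists_gibbs W hT hξ hS hext hC' (by linarith) hc hc0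
  have he := langEntropy_le_entropyRate hT.measurable hξm hμC
  refine ⟨⟨μ, hμ, he, fun ν hν heν => ?_⟩, ⟨C + 1, by linarith, hC'⟩, c, hc0, τ, hc⟩
  have := eq_of_hasTwoWordBound W hμ hξm (by linarith) hC' hgood hμ2 he hν heν
  exact Subtype.ext this

end Coded

/-! ### Periodic points -/

section Periodic

variable {Y A : Type*} {T : Y → Y} {ξ : Y → A}

/-- The points of period at most `n`. -/
def periodicUpTo (T : Y → Y) (n : ℕ) : Set Y :=
  {x | ∃ k : ℕ, 1 ≤ k ∧ k ≤ n ∧ Function.IsPeriodicPt T k x}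

/-- One period determines the whole forward itinerary. By periodicity a point is also a forward
image of itself under `offset m` iterates, so this itinerary determines every window, including the
left half of a two-sided one. -/
lemma eq_of_isPeriodicPt_of_word_eq [TopologicalSpace Y] (W : WindowCoding T ξ) {k : ℕ}
    (hk : 0 < k) {y z : Y} (hy : Function.IsPeriodicPt T k y) (hz : Function.IsPeriodicPt T k z)
    (h : word T ξ k y = word T ξ k z) : y = z := by
  have h1 : ∀ i, ξ (T^[i] y) = ξ (T^[i] z) := fun i => by
    rw [← hy.iterate_mod_apply i, ← hz.iterate_mod_apply i]
    exact congrFun (List.ofFn_injective h) ⟨i % k, Nat.mod_lt i hk⟩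
  refine W.eq_of_window_eq y z fun m => ?_
  have h2 : W.offset m ≤ k * W.offset m := Nat.le_mul_of_pos_left _ hk
  have h3 : ∀ x, Function.IsPeriodicPt T k x →
      T^[W.offset m] (T^[k * W.offset m - W.offset m] x) = x := fun x hx => by
    rw [← Function.iterate_add_apply, Nat.add_sub_cancel' h2]
    exact hx.mul_const _
  rw [← h3 y hy, ← h3 z hz, W.window_iterate, W.window_iterate]
  funext i
  simp only [itinerary, ← Function.iterate_add_apply, h1]

lemma injOn_word_periodic [TopologicalSpace Y] (W : WindowCoding T ξ) {k : ℕ} (hk : 0 < k) :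
    InjOn (word T ξ k) {x | Function.IsPeriodicPt T k x} :=
  fun _ hy _ hz h => eq_of_isPeriodicPt_of_word_eq W hk hy hz h

lemma finite_periodic [TopologicalSpace Y] [Finite A] (W : WindowCoding T ξ) {k : ℕ} (hk : 0 < k) :
    {x | Function.IsPeriodicPt T k x}.Finite :=
  Finite.of_finite_image (finite_word_image T ξ k _) (injOn_word_periodic W hk)

lemma periodicUpTo_eq (T : Y → Y) (n : ℕ) :
    periodicUpTo T n = ⋃ k ∈ Finset.Icc 1 n, {x | Function.IsPeriodicPt T k x} := by
  ext x; simp [periodicUpTo, and_assoc]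

lemma finite_periodicUpTo [TopologicalSpace Y] [Finite A] (W : WindowCoding T ξ) (n : ℕ) :
    (periodicUpTo T n).Finite := by
  rw [periodicUpTo_eq]
  exact (Finset.Icc 1 n).finite_toSet.biUnion fun k hk =>
    finite_periodic W (by simp at hk; omega)

/-- Points of period k are counted by their first k letters. For k < |w| all words are allowed,
which gives the first term; for k ≥ |w| the first |w| letters are fixed, and the bounds C
e^{(k-|w|)h} form a geometric sum, which needs h > 0. -/
lemma ncard_periodicUpTo_inter_cyl_le [TopologicalSpace Y] [Finite A] (W : WindowCoding T ξ)
    {C h : ℝ} (h0 : 0 < h) (hC0 : 0 < C)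
    (hC : ∀ n : ℕ, (count T ξ n univ : ℝ) ≤ C * Real.exp (n * h)) (w : List A) (n : ℕ) :
    ((periodicUpTo T n ∩ cyl T ξ w).ncard : ℝ) ≤
      w.length * (C * Real.exp (w.length * h)) +
        C * Real.exp (-(w.length * h)) *
          (Real.exp h / (Real.exp h - 1) * Real.exp (n * h)) := by
  have h1 : ∀ k ∈ Finset.Icc 1 n,
      (({x | Function.IsPeriodicPt T k x} ∩ cyl T ξ w).ncard : ℝ) ≤
      (if k < w.length then C * Real.exp (w.length * h) else 0) +
        C * Real.exp (-(w.length * h)) * Real.exp h ^ k := by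
    intro k hk
    have hk0 : 0 < k := (Finset.mem_Icc.1 hk).1
    have e1 : ({x | Function.IsPeriodicPt T k x} ∩ cyl T ξ w).ncard ≤ count T ξ k (cyl T ξ w) := by
      rw [count, ← ((injOn_word_periodic W hk0).mono inter_subset_left).ncard_image]
      exact ncard_le_ncard (image_mono inter_subset_right) (finite_word_image T ξ k _)
    have e1' : (({x | Function.IsPeriodicPt T k x} ∩ cyl T ξ w).ncard : ℝ) ≤
        count T ξ k (cyl T ξ w) := by exact_mod_cast e1
    refine e1'.trans ?_
    split_ifs with hkw
    · have e2 : (count T ξ k (cyl T ξ w) : ℝ) ≤ count T ξ k univ := by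
        exact_mod_cast count_mono T ξ (subset_univ _) k
      have e3 : Real.exp (k * h) ≤ Real.exp (w.length * h) := by gcongr
      have e4 := mul_le_mul_of_nonneg_left e3 hC0.le
      have e5 : 0 ≤ C * Real.exp (-(w.length * h)) * Real.exp h ^ k := by positivity
      linarith [hC k]
    · obtain ⟨r, rfl⟩ := Nat.exists_eq_add_of_le (not_lt.1 hkw)
      have e2 : count T ξ (w.length + r) (cyl T ξ w) ≤
          count T ξ w.length (cyl T ξ w) * count T ξ r univ := by
        have := count_add_le T ξ w.length r (cyl T ξ w) univ
        rwa [preimage_univ, inter_univ] at this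
      have e3 : count T ξ w.length (cyl T ξ w) ≤ 1 := by
        have : word T ξ w.length '' cyl T ξ w ⊆ {w} := by rintro _ ⟨y, hy, rfl⟩; exact hy
        exact (ncard_le_ncard this).trans (ncard_singleton w).le
      have e4 : (count T ξ (w.length + r) (cyl T ξ w) : ℝ) ≤ count T ξ r univ := by
        exact_mod_cast e2.trans (Nat.mul_le_mul_right _ e3) |>.trans (one_mul _).le
      rw [zero_add]
      refine e4.trans ((hC r).trans (le_of_eq ?_))
      rw [← Real.exp_nat_mul, mul_assoc, ← Real.exp_add]
      push_cast; congr 2; ring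
  have h2 : (periodicUpTo T n ∩ cyl T ξ w).ncard ≤
      ∑ k ∈ Finset.Icc 1 n, ({x | Function.IsPeriodicPt T k x} ∩ cyl T ξ w).ncard := by
    rw [periodicUpTo_eq, iUnion₂_inter]
    refine ncard_biUnion_le _ _ fun k hk => ?_
    exact (finite_periodic W (by simp at hk; omega)).subset inter_subset_left
  have h3 : ((periodicUpTo T n ∩ cyl T ξ w).ncard : ℝ) ≤
      ∑ k ∈ Finset.Icc 1 n, (({x | Function.IsPeriodicPt T k x} ∩ cyl T ξ w).ncard : ℝ) := by
    exact_mod_cast h2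
  refine h3.trans ((Finset.sum_le_sum h1).trans ?_)
  rw [Finset.sum_add_distrib, ← Finset.mul_sum, ← Finset.sum_filter, Finset.sum_const, nsmul_eq_mul]
  have hr : 1 < Real.exp h := Real.one_lt_exp_iff.2 h0
  have hr' : 0 < Real.exp h - 1 := by linarith
  have h4 : (((Finset.Icc 1 n).filter fun k => k < w.length).card : ℝ) ≤ w.length := by
    have : (Finset.Icc 1 n).filter (fun k => k < w.length) ⊆ Finset.range w.length := by
      intro k hk
      simp only [Finset.mem_filter] at hk
      exact Finset.mem_range.2 hk.2
    exact_mod_cast (Finset.card_le_card this).trans (Finset.card_range _).le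
  have h5 : ∑ k ∈ Finset.Icc 1 n, Real.exp h ^ k ≤
      Real.exp h / (Real.exp h - 1) * Real.exp (n * h) := by
    have e1 : ∑ k ∈ Finset.Icc 1 n, Real.exp h ^ k ≤ ∑ k ∈ Finset.range (n + 1), Real.exp h ^ k := by
      refine Finset.sum_le_sum_of_subset_of_nonneg (fun k hk => ?_) fun _ _ _ => by positivity
      simp only [Finset.mem_Icc, Finset.mem_range] at hk ⊢; omega
    rw [geom_sum_eq hr.ne'] at e1
    refine e1.trans ?_
    rw [Real.exp_nat_mul, div_mul_eq_mul_div, pow_succ']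
    gcongr
    linarith
  gcongr

lemma ncard_layer_le_ncard_periodicUpTo [TopologicalSpace Y] [Finite A] (W : WindowCoding T ξ)
    {G : Set (List A)} {t : ℕ}
    (hP : ∀ w ∈ G, ∃ y ∈ cyl T ξ w, Function.IsPeriodicPt T (w.length + t) y) {n N : ℕ}
    (hn : 1 ≤ n) (hN : n + t ≤ N) : (layer G n).ncard ≤ (periodicUpTo T N).ncard := by
  have hsub : layer G n ⊆ word T ξ n '' periodicUpTo T N := by
    rintro w ⟨hw, hl⟩
    obtain ⟨y, hy, hper⟩ := hP w hw
    rw [hl] at hper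
    refine ⟨y, ⟨n + t, by omega, hN, hper⟩, ?_⟩
    rw [cyl_subset_of_length T ξ hl] at hy
    exact hy
  have hf := finite_periodicUpTo W N
  exact (ncard_le_ncard hsub (hf.image _)).trans (ncard_image_le hf)

/-- Periodic points are permuted by the dynamics. -/
lemma measurePreserving_empirical_periodicUpTo [MeasurableSpace Y] (hT : Measurable T) {n : ℕ}
    (hf : (periodicUpTo T n).Finite) :
    MeasurePreserving T (empirical hf.toFinset id) (empirical hf.toFinset id) := by
  classical
  refine ⟨hT, Measure.ext fun B hB => ?_⟩
  rw [Measure.map_apply hT hB, empirical_apply _ _ (hT hB), empirical_apply _ _ hB]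
  congr 2
  refine Finset.card_bij (fun x _ => T x) ?_ ?_ ?_
  · intro x hx
    simp only [Finset.mem_filter, Finite.mem_toFinset, id, mem_preimage] at hx ⊢
    obtain ⟨⟨k, h1, h2, h3⟩, hxB⟩ := hx
    exact ⟨⟨k, h1, h2, h3.apply⟩, hxB⟩
  · intro x hx y hy hxy
    simp only [Finset.mem_filter, Finite.mem_toFinset] at hx hy
    obtain ⟨⟨k, h1, -, h3⟩, -⟩ := hx
    obtain ⟨⟨l, h1', -, h3'⟩, -⟩ := hy
    -- Both points return at the common time kl ≥ 1, so equal images under T force them to be equal.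
    have e1 : T^[k * l] x = x := h3.mul_const l
    have e2 : T^[k * l] y = y := h3'.const_mul k
    obtain ⟨r, hr⟩ := Nat.exists_eq_succ_of_ne_zero (Nat.mul_ne_zero (by omega : k ≠ 0)
      (by omega : l ≠ 0))
    rw [hr, Function.iterate_succ_apply] at e1 e2
    rw [← e1, ← e2, hxy]
  · intro y hy
    simp only [Finset.mem_filter, Finite.mem_toFinset, id] at hy
    obtain ⟨⟨k, h1, h2, h3⟩, hyB⟩ := hy
    obtain ⟨r, rfl⟩ := Nat.exists_eq_succ_of_ne_zero (by omega : k ≠ 0)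
    have e1 : T (T^[r] y) = y := by rw [← Function.iterate_succ_apply' T]; exact h3
    refine ⟨T^[r] y, ?_, e1⟩
    simp only [Finset.mem_filter, Finite.mem_toFinset, id, mem_preimage]
    exact ⟨⟨r + 1, h1, h2, h3.apply_iterate r⟩, by rwa [e1]⟩

end Periodic

/-! ### Limits of the periodic measures -/

section PeriodicLimit

variable {Y : Type*} [TopologicalSpace Y] [CompactSpace Y] [T2Space Y] [MeasurableSpace Y]
  [BorelSpace Y] [HasOuterApproxClosed Y] [Nonempty Y] {A : Type*} [Fintype A]
  {T : Y → Y} {ξ : Y → A}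

/-- The uniform measures on periodic points converge to the unique measure of full entropy. -/
lemma tendsto_empirical_periodicUpTo (W : WindowCoding T ξ) (hT : Continuous T)
    (hξ : IsLocallyConstant ξ) (hξm : MeasurableLevels ξ) {G : Set (List A)} {C c : ℝ} {t τ : ℕ}
    (hC : ∀ n : ℕ, (count T ξ n univ : ℝ) ≤ C * Real.exp (n * langEntropy T ξ)) (hC0 : 0 < C)
    (hc : ∀ n : ℕ, ∃ j ≤ τ, c * Real.exp (n * langEntropy T ξ) ≤ (layer G (n + j)).ncard)
    (hc0 : 0 < c)
    (hP : ∀ w ∈ G, ∃ y ∈ cyl T ξ w, Function.IsPeriodicPt T (w.length + t) y)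
    {μ : ProbabilityMeasure Y}
    (hμ : ∀ ν : ProbabilityMeasure Y, MeasurePreserving T (ν : Measure Y) (ν : Measure Y) →
        langEntropy T ξ ≤ entropyRate T (ν : Measure Y) ξ → ν = μ) :
    ∃ ν : ℕ → ProbabilityMeasure Y, (∀ᶠ n in atTop, (ν n : Measure Y) =
      empirical (finite_periodicUpTo W n).toFinset id) ∧ Tendsto ν atTop (𝓝 μ) := by
  classical
  set h := langEntropy T ξ
  set P : ℕ → Finset Y := fun n => (finite_periodicUpTo W n).toFinset with hPdef
  set c' := c * Real.exp (-((τ + t) * h)) with hc'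
  have hc'0 : 0 < c' := by positivity
  have hlow : ∀ n ≥ τ + t + 1, c' * Real.exp (n * h) ≤ (P n).card := by
    intro n hn
    -- Whatever j ≤ τ occurs, the word length plus t stays at most n, and n > τ + t keeps it
    -- positive.
    obtain ⟨j, hj, hcj⟩ := hc (n - (τ + t))
    have e1 : (layer G (n - (τ + t) + j)).ncard ≤ (periodicUpTo T n).ncard :=
      ncard_layer_le_ncard_periodicUpTo W hP (by omega) (by omega)
    rw [ncard_eq_toFinset_card _ (finite_periodicUpTo W n)] at e1
    have e1' : ((layer G (n - (τ + t) + j)).ncard : ℝ) ≤ (P n).card := by exact_mod_cast e1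
    refine le_trans (le_of_eq ?_) (hcj.trans e1')
    rw [hc', mul_assoc, ← Real.exp_add, Nat.cast_sub (by omega)]
    push_cast; congr 2; ring
  have hne : ∀ n ≥ τ + t + 1, (P n).Nonempty := fun n hn => by
    rw [← Finset.card_pos]
    have : (0 : ℝ) < (P n).card := lt_of_lt_of_le (by positivity) (hlow n hn)
    exact_mod_cast this
  set ν : ℕ → ProbabilityMeasure Y := fun n =>
    if hn : (P n).Nonempty then ⟨empirical (P n) id, isProbabilityMeasure_empirical hn id⟩ else μ
    with hν
  have hνn : ∀ n ≥ τ + t + 1, (ν n : Measure Y) = empirical (P n) id := fun n hn => by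
    have : ν n = ⟨empirical (P n) id, isProbabilityMeasure_empirical (hne n hn) id⟩ :=
      dif_pos (hne n hn)
    rw [this]; rfl
  have hνinv : ∀ n ≥ τ + t + 1, MeasurePreserving T (ν n : Measure Y) (ν n : Measure Y) :=
    fun n hn => by
      rw [hνn n hn]; exact measurePreserving_empirical_periodicUpTo hT.measurable _
  refine ⟨ν, eventually_atTop.2 ⟨_, hνn⟩, ?_⟩
  -- If h = 0, every invariant probability measure has full entropy, so uniqueness already
  -- identifies the periodic measures with μ.
  rcases (langEntropy_nonneg T ξ).eq_or_lt with h0 | h0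
  · refine tendsto_const_nhds.congr' (eventually_atTop.2 ⟨τ + t + 1, fun n hn => ?_⟩)
    refine (hμ _ (hνinv n hn) ?_).symm
    refine le_entropyRate_of_forall (C := 0) fun m => ?_
    rw [show h = 0 from h0.symm]; simpa using partitionEntropy_nonneg _ _
  -- By compactness the measures converge along each ultrafilter, so it suffices to identify each
  -- such limit as μ.
  rw [tendsto_iff_ultrafilter]
  intro F hF
  obtain ⟨l, -, hl⟩ := isCompact_univ.ultrafilter_le_nhds (F.map ν) (by simp)
  have hlim : Tendsto ν F (𝓝 l) := hl
  have hev : ∀ᶠ n in (F : Filter ℕ), n ≥ τ + t + 1 := hF (eventually_ge_atTop _)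
  suffices l = μ by rwa [this] at hlim
  refine hμ l (measurePreserving_of_tendsto W hT hlim fun B hB => ?_) ?_
  · refine tendsto_const_nhds.congr' ?_
    filter_upwards [hev] with n hn
    rw [(hνinv n hn).measureReal_preimage hB.nullMeasurableSet, sub_self]
  set K := C * (Real.exp h / (Real.exp h - 1)) / c' with hK
  refine langEntropy_le_entropyRate hT.measurable hξm (K := K) fun w => ?_
  have hB := isClopen_cyl hT hξ w
  -- The periods shorter than w contribute a number independent of n, negligible against #Per(n) ≥
  -- c' e^{nh}.
  set a := w.length * (C * Real.exp (w.length * h)) / c' with ha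
  have h1 : Tendsto (fun n : ℕ => a * Real.exp (-(n * h)) + K * Real.exp (-(w.length * h))) F
      (𝓝 (a * 0 + K * Real.exp (-(w.length * h)))) := by
    refine Tendsto.add_const _ (Tendsto.const_mul _ ?_)
    refine Tendsto.mono_left ?_ hF
    exact Real.tendsto_exp_neg_atTop_nhds_zero.comp
      (tendsto_natCast_atTop_atTop.atTop_mul_const h0)
  rw [mul_zero, zero_add] at h1
  refine le_of_tendsto_of_tendsto (tendsto_measureReal_of_isClopen hlim hB) h1 ?_
  filter_upwards [hev] with n hn
  rw [hνn n hn, empirical_real _ _ hB.isOpen.measurableSet]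
  have e1 : ((P n).filter fun i => id i ∈ cyl T ξ w).card =
      (periodicUpTo T n ∩ cyl T ξ w).ncard := by
    rw [← ncard_coe_finset]; congr 1; ext x; simp [hPdef]
  rw [e1]
  have e2 := ncard_periodicUpTo_inter_cyl_le W h0 hC0 hC w n
  have e3 := hlow n hn
  have e4 : 0 < c' * Real.exp (n * h) := by positivity
  calc ((periodicUpTo T n ∩ cyl T ξ w).ncard : ℝ) / (P n).card
      ≤ ((periodicUpTo T n ∩ cyl T ξ w).ncard : ℝ) / (c' * Real.exp (n * h)) := by gcongr
    _ ≤ (w.length * (C * Real.exp (w.length * h)) + C * Real.exp (-(w.length * h)) *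
          (Real.exp h / (Real.exp h - 1) * Real.exp (n * h))) / (c' * Real.exp (n * h)) := by
        gcongr
    _ = _ := by
        rw [ha, hK, Real.exp_neg (n * h)]
        field_simp

end PeriodicLimit

/-! ### Topological entropy is at most the growth rate of the language -/

section TopologicalEntropy

variable {Y A : Type*} {T : Y → Y} {ξ : Y → A}

/-- Otherwise, by compactness, some pair outside the interior of U would agree in all windows. It
would lie on the diagonal, which that interior contains. -/
lemma exists_window_subset_entourage [UniformSpace Y] [CompactSpace Y] (W : WindowCoding T ξ)
    {U : SetRel Y Y} (hU : U ∈ uniformity Y) :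
    ∃ m, ∀ y z, W.window m y = W.window m z → (y, z) ∈ U := by
  by_contra! hcon
  have hclosed : ∀ m, IsClosed {q : Y × Y | W.window m q.1 = W.window m q.2} := fun m => by
    have h : IsLocallyConstant fun q : Y × Y => (W.window m q.1, W.window m q.2) :=
      ((W.isLocallyConstant m).comp_continuous continuous_fst).prodMk
        ((W.isLocallyConstant m).comp_continuous continuous_snd)
    rw [← isOpen_compl_iff]
    exact h {c | c.1 ≠ c.2}
  have hi : interior U ∈ uniformity Y := interior_mem_uniformity hU
  have h := IsCompact.nonempty_iInter_of_sequence_nonempty_isCompact_isClosed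
    (fun m => {q : Y × Y | W.window m q.1 = W.window m q.2} ∩ (interior U)ᶜ)
    (fun m q hq => ⟨W.window_eq_of_succ m _ _ hq.1, hq.2⟩)
    (fun m => by
      obtain ⟨y, z, hyz, hn⟩ := hcon m
      exact ⟨(y, z), hyz, fun hm => hn (interior_subset hm)⟩)
    ((hclosed 0).inter isOpen_interior.isClosed_compl).isCompact
    (fun m => (hclosed m).inter isOpen_interior.isClosed_compl)
  obtain ⟨⟨y, z⟩, hq⟩ := h
  rw [mem_iInter] at hq
  have hyz : y = z := W.eq_of_window_eq y z fun m => (hq m).1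
  subst hyz
  exact (hq 0).2 (refl_mem_uniformity hi)

/-- One centre is used for each word of length n + `size m`: points with the same word have, after
`offset m` iterates, the same m-th window at each of n successive times. Surjectivity ensures that
these iterates reach every point. -/
lemma coverMincard_le_count [TopologicalSpace Y] [Finite A] [Nonempty Y] (W : WindowCoding T ξ)
    {U : SetRel Y Y} {m : ℕ} (hU : ∀ y z, W.window m y = W.window m z → (y, z) ∈ U) (n : ℕ) :
    Dynamics.coverMincard T univ U n ≤ count T ξ (n + W.size m) univ := by
  classical
  set N := n + W.size m
  set s : Finset Y := (wordFinset T ξ N).image fun w => T^[W.offset m] (wordPoint T ξ N w)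
  have hcov : Dynamics.IsDynCoverOf T univ U n s := by
    intro x _
    obtain ⟨x', rfl⟩ := W.surjective m x
    have hw : word T ξ N x' ∈ wordFinset T ξ N := (Finite.mem_toFinset _).2 ⟨x', trivial, rfl⟩
    refine ⟨T^[W.offset m] (wordPoint T ξ N (word T ξ N x')),
      Finset.mem_coe.2 (Finset.mem_image_of_mem _ hw), ?_⟩
    refine Dynamics.mem_dynEntourage.2 fun k hk => hU _ _ ?_
    have hc : ∀ y, T^[k] (T^[W.offset m] y) = T^[W.offset m] (T^[k] y) := fun y =>
      (Function.Commute.iterate_iterate_self T k (W.offset m)).eq y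
    rw [hc, hc, W.window_iterate, W.window_iterate]
    have := word_iterate_eq (n := W.size m) (k := k) (by omega) (word_wordPoint T ξ hw)
    exact (List.ofFn_injective this).symm
  refine hcov.coverMincard_le_card.trans ?_
  rw [← card_wordFinset]
  exact_mod_cast Finset.card_image_le

lemma coverEntropy_le_langEntropy [UniformSpace Y] [CompactSpace Y] [Nonempty Y] [Finite A]
    (W : WindowCoding T ξ) : Dynamics.coverEntropy T univ ≤ langEntropy T ξ := by
  refine iSup₂_le fun U hU => ?_
  obtain ⟨m, hm⟩ := exists_window_subset_entourage W hU
  refine ExpGrowth.expGrowthSup_le_iff.2 fun b hb => ?_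
  obtain ⟨r, hr, hrb⟩ := EReal.lt_iff_exists_real_btwn.1 hb
  set h := langEntropy T ξ
  have hrh : h < r := by exact_mod_cast hr
  obtain ⟨C, hC0, hC⟩ := exists_count_le_exp T ξ (half_pos (sub_pos.2 hrh))
  set ε := (r - h) / 2 with hε
  have hε0 : 0 < ε := half_pos (sub_pos.2 hrh)
  set q := W.size m
  have hlim : Tendsto (fun n : ℕ => Real.exp (n * ε)) atTop atTop :=
    Real.tendsto_exp_atTop.comp (tendsto_natCast_atTop_atTop.atTop_mul_const hε0)
  filter_upwards [hlim.eventually_ge_atTop (C * Real.exp (q * (h + ε)))] with n hn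
  have h1 : (count T ξ (n + q) univ : ℝ) ≤ Real.exp (r * n) := by
    refine (hC (n + q)).trans ?_
    calc C * Real.exp ((n + q : ℕ) * (h + ε))
        = C * Real.exp (q * (h + ε)) * Real.exp (n * (h + ε)) := by
          rw [mul_assoc, ← Real.exp_add]; push_cast; congr 2; ring
      _ ≤ Real.exp (n * ε) * Real.exp (n * (h + ε)) := by gcongr
      _ = Real.exp (r * n) := by rw [← Real.exp_add, hε]; congr 1; ring
  have h2 : ((count T ξ (n + q) univ : ℕ) : ENNReal) ≤ EReal.exp (r * n) := by
    have e1 : (r : EReal) * (n : EReal) = ((r * n : ℝ) : EReal) := by push_cast; rfl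
    rw [e1, EReal.exp_coe, ← ENNReal.ofReal_natCast]
    exact ENNReal.ofReal_le_ofReal h1
  refine le_trans ?_ (h2.trans ?_)
  · have := ENat.toENNReal_le.2 (coverMincard_le_count W hm n)
    rwa [ENat.toENNReal_coe] at this
  · gcongr

end TopologicalEntropy

/-! ### Shift spaces as coded systems -/

section Subshift

variable {p : ℕ} {I : Type*} [AddMonoidWithOne I] (X : Subshift (Fin p) I)

/-- The letter at the origin. -/
def letter (x : X.carrier) : Fin p := x.1 0

lemma iterate_shiftMap_apply (k : ℕ) (x : X.carrier) (i : I) :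
    ((shiftMap X)^[k] x).1 i = x.1 (k + i) := by
  induction k generalizing i with
  | zero => simp
  | succ k ih =>
    rw [Function.iterate_succ_apply']
    change ((shiftMap X)^[k] x).1 (1 + i) = _
    rw [ih, ← add_assoc, Nat.cast_succ]

lemma itinerary_letter (n : ℕ) (x : X.carrier) (i : Fin n) :
    itinerary (shiftMap X) (letter X) n x i = x.1 ((i : ℕ) : I) := by
  simp [itinerary, letter, iterate_shiftMap_apply]

lemma cyl_letter (w : List (Fin p)) : cyl (shiftMap X) (letter X) w = cylinder X w := by
  ext x
  simp only [cyl, cylinder, mem_ofPred_eq, word]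
  constructor
  · intro h k hk
    have := List.getElem_of_eq h.symm hk
    rw [this, List.getElem_ofFn, itinerary_letter]
  · intro h
    refine List.ext_getElem (by simp) fun k h1 h2 => ?_
    rw [List.getElem_ofFn, itinerary_letter]
    exact h k h2

lemma lang_letter : lang (shiftMap X) (letter X) = language X := by
  ext w
  simp only [lang, cyl_letter, cylinder, language, mem_ofPred_eq]
  constructor
  · rintro ⟨x, hx⟩
    exact ⟨x.1, x.2, 0, fun k hk => by rw [zero_add]; exact hx k hk⟩
  · rintro ⟨x, hx, i, h⟩
    -- Shift invariance moves an occurrence at any position to the origin.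
    exact ⟨⟨_, X.mapsTo i hx⟩, fun k hk => h k hk⟩

lemma continuous_shiftMap : Continuous (shiftMap X) :=
  (SymbolicDynamics.FullShift.continuous_shift (1 : I)).restrict _

lemma isLocallyConstant_coordinate (i : I) : IsLocallyConstant fun x : X.carrier => x.1 i :=
  (IsLocallyConstant.iff_continuous _).2 ((continuous_apply i).comp continuous_subtype_val)

lemma isLocallyConstant_pi {Y ι : Type*} [TopologicalSpace Y] {n : ℕ} {f : Fin n → Y → ι}
    (hf : ∀ i, IsLocallyConstant (f i)) : IsLocallyConstant fun y i => f i y := by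
  rw [IsLocallyConstant.iff_eventually_eq]
  intro x
  filter_upwards [eventually_all.2 fun i => (hf i).eventually_eq x] with y hy
  exact funext hy

/-- Windows of a one-sided shift space: initial words. -/
def windowCodingNat (X : Subshift (Fin p) ℕ) : WindowCoding (shiftMap X) (letter X) where
  size m := m
  offset _ := 0
  window _ x i := x.1 i
  isLocallyConstant _ := isLocallyConstant_pi fun i => isLocallyConstant_coordinate X i
  window_eq_of_succ _ _ _ h := funext fun i => congrFun h i.castSucc
  eq_of_window_eq _ _ h := Subtype.ext <| funext fun i => congrFun (h (i + 1)) (Fin.last i)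
  window_iterate m y := funext fun i => (itinerary_letter X m y i).symm
  surjective _ := Function.surjective_id

/-- Windows of a two-sided shift space: central words. -/
def windowCodingInt (X : Subshift (Fin p) ℤ) : WindowCoding (shiftMap X) (letter X) where
  size m := 2 * m + 1
  offset m := m
  window m x i := x.1 (i - m)
  isLocallyConstant m := isLocallyConstant_pi fun i => isLocallyConstant_coordinate X (i - m)
  window_eq_of_succ _ _ _ h := funext fun i => by
    have := congrFun h ⟨i + 1, by omega⟩
    simpa using this
  eq_of_window_eq _ _ h := Subtype.ext <| funext fun i => by
    -- Coordinate i stands at position i + |i| of the window of radius |i|.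
    have := congrFun (h i.natAbs) ⟨(i + i.natAbs).toNat, by omega⟩
    have e : (((i + i.natAbs).toNat : ℕ) : ℤ) - i.natAbs = i := by omega
    simpa only [e] using this
  window_iterate m y := funext fun i => by
    rw [itinerary_letter, iterate_shiftMap_apply]
    exact congrArg y.1 (by ring)
  surjective m := by
    refine Function.Surjective.iterate (fun x => ?_) m
    refine ⟨⟨_, X.mapsTo (-1) x.2⟩, Subtype.ext <| funext fun i => ?_⟩
    exact congrArg x.1 (by ring : -1 + (1 + i) = i)

/-- Existence and uniqueness of the measure of maximal entropy, and the distribution of periodic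
points, for shift spaces over an index set that admits windows. -/
theorem intrinsicallyErgodic_of_windowCoding [Countable I]
    (W : WindowCoding (shiftMap X) (letter X)) {Cp G Cs : Set (List (Fin p))}
    (hdec : IsDecomposition (language X) Cp G Cs)
    (hS : ∃ t : ℕ, HasSSpecification (language X) G t)
    (hgr : growthRate (Cp ∪ Cs) < topEntropy X)
    (hext : HasBoundedExtension (language X) Cp G Cs) :
    IntrinsicallyErgodic (shiftMap X) ∧
      ((∃ t : ℕ, HasPerSpecification X G t) →
        ∀ μ : ProbabilityMeasure X.carrier, IsMME (shiftMap X) μ →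
          ∃ ν : ℕ → ProbabilityMeasure X.carrier,
            (∀ᶠ n in atTop, (ν n : Measure X.carrier) = perMeasure X n) ∧
            Tendsto ν atTop (𝓝 μ)) := by
  have hcpt : CompactSpace X.carrier := isCompact_iff_compactSpace.1 X.isClosed.isCompact
  -- The empty shift has topological entropy -∞, which the strict entropy gap excludes.
  have hne : Nonempty X.carrier := by
    by_contra hcon
    rw [not_nonempty_iff] at hcon
    refine not_lt_bot (hgr.trans_eq ?_)
    unfold topEntropy
    rw [univ_eq_empty_iff.2 hcon]
    let : UniformSpace (Fin p) := ⊥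
    let : UniformSpace (I → Fin p) := Pi.uniformSpace _
    let : UniformSpace X.carrier := instUniformSpaceSubtype
    exact Dynamics.coverEntropy_empty
  have htop : topEntropy X ≤ langEntropy (shiftMap X) (letter X) := by
    unfold topEntropy
    let : UniformSpace (Fin p) := ⊥
    let : UniformSpace (I → Fin p) := Pi.uniformSpace _
    let u : UniformSpace X.carrier := instUniformSpaceSubtype
    exact @coverEntropy_le_langEntropy _ _ _ _ u hcpt hne _ W
  have hT := continuous_shiftMap X
  have hξ : IsLocallyConstant (letter X) := isLocallyConstant_coordinate X 0
  have hξm : MeasurableLevels (letter X) := fun a => (hξ {a}).measurableSet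
  rw [← lang_letter] at hdec hS hext
  obtain ⟨t, hS⟩ := hS
  obtain ⟨⟨μ, hμ, he, huniq⟩, ⟨C, hC0, hC⟩, c, hc0, τ, hc⟩ :=
    exists_unique_max_entropy W hT hξ hξm hdec hS (hgr.trans_le htop) hext
  have hiff := isMME_iff W hξm hμ he
  refine ⟨⟨μ, (hiff μ).2 ⟨hμ, he⟩, fun ν hν => ?_⟩, ?_⟩
  · obtain ⟨h1, h2⟩ := (hiff ν).1 hν
    exact huniq ν h1 h2
  rintro ⟨t', hP⟩ μ' hμ'
  obtain rfl : μ' = μ := huniq μ' ((hiff μ').1 hμ').1 ((hiff μ').1 hμ').2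
  have hP' : ∀ w ∈ G, ∃ y ∈ cyl (shiftMap X) (letter X) w,
      Function.IsPeriodicPt (shiftMap X) (w.length + t') y := by
    intro w hw
    -- Only single words are needed: each word of G is followed by a point of period |w| + t' in its
    -- cylinder.
    obtain ⟨vs, ⟨hl, -, -⟩, y, hy, hper⟩ := hP [w] (by simp) (by simpa using hw)
    obtain rfl : vs = [] := List.length_eq_zero_iff.1 (by simpa using hl)
    have e : glue [w] [] = w := by simp [glue]
    rw [e] at hy hper
    exact ⟨y, by rwa [cyl_letter], hper⟩
  obtain ⟨ν, hν, hlim⟩ := tendsto_empirical_periodicUpTo W hT hξ hξm hC hC0 hc hc0 hP' huniq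
  refine ⟨ν, hν.mono fun n hn => ?_, hlim⟩
  rw [hn, perMeasure, empirical]
  have hf := finite_periodicUpTo W n
  congr 2
  · exact congrArg _ (ncard_eq_toFinset_card _ hf).symm
  · have : Fintype (Per X n) := hf.fintype
    rw [Measure.sum_fintype]
    refine (Finset.sum_subtype _ (fun x => ?_) _)
    rw [Finite.mem_toFinset]; rfl

end Subshift

end ShiftSpace

end

open ShiftSpace in
/-- The first half is about one-sided, the second half about two-sided shift spaces. -/
theorem theoremC (p : ℕ) :
    (∀ (X : Subshift (Fin p) ℕ) (Cp G Cs : Set (List (Fin p))),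
      IsDecomposition (language X) Cp G Cs →
      (∃ t : ℕ, HasSSpecification (language X) G t) →
      growthRate (Cp ∪ Cs) < topEntropy X →
      HasBoundedExtension (language X) Cp G Cs →
      IntrinsicallyErgodic (shiftMap X) ∧
      ((∃ t : ℕ, HasPerSpecification X G t) →
        ∀ μ : ProbabilityMeasure X.carrier, IsMME (shiftMap X) μ →
          ∃ ν : ℕ → ProbabilityMeasure X.carrier,
            (∀ᶠ n in atTop, (ν n : Measure X.carrier) = perMeasure X n) ∧
            Tendsto ν atTop (𝓝 μ))) ∧
    (∀ (X : Subshift (Fin p) ℤ) (Cp G Cs : Set (List (Fin p))),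
      IsDecomposition (language X) Cp G Cs →
      (∃ t : ℕ, HasSSpecification (language X) G t) →
      growthRate (Cp ∪ Cs) < topEntropy X →
      HasBoundedExtension (language X) Cp G Cs →
      IntrinsicallyErgodic (shiftMap X) ∧
      ((∃ t : ℕ, HasPerSpecification X G t) →
        ∀ μ : ProbabilityMeasure X.carrier, IsMME (shiftMap X) μ →
          ∃ ν : ℕ → ProbabilityMeasure X.carrier,
            (∀ᶠ n in atTop, (ν n : Measure X.carrier) = perMeasure X n) ∧
            Tendsto ν atTop (𝓝 μ))) := by
  exact ⟨fun X _ _ _ hdec hS hgr hext =>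
      intrinsicallyErgodic_of_windowCoding X (windowCodingNat X) hdec hS hgr hext,
    fun X _ _ _ hdec hS hgr hext =>
      intrinsicallyErgodic_of_windowCoding X (windowCodingInt X) hdec hS hgr hext⟩
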